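/- Let $k$ be an algebraically closed field and let $\mathcal A$ be a $k$-linear abelian category which is Deligne finite: its $\mathrm{Hom}$ and $\mathrm{Ext}^1$ spaces are finite-dimensional, every object is Noetherian and Artinian, there are finitely many simple objects up to isomorphism, and there are enough projective objects. Fix an ordering $S_1,\dots,S_n$ of representatives of the isomorphism classes of simple objects. Let $P_i$ be a projective cover and $I_i$ an injective hull of $S_i$, and let $\mathcal A_i=\langle S_1,\dots,S_i\rangle$ be the extension closure of the first $i$ simple objects. Let the standard object $\Delta_i$ be the maximal quotient of $P_i$ lying in $\mathcal A_i$, and the costandard object $\nabla_i$ the maximal subobject of $I_i$ lying in $\mathcal A_i$. Write $[A]$ for the class of $A$ in the Grothendieck group $K(\mathcal A)$, and $[A:S]$ for the multiplicity of the simple object $S$ in a Jordan–Hölder filtration of $A$. A stability function is a group homomorphism $Z\colon K(\mathcal A)\to\mathbb C$ with $Z([A])\in\{re^{i\pi\phi}\mid r>0,\ \phi\in(0,1]\}$ for every $A\neq 0$; the phase $\phi(A)\in(0,1]$ of $A\ne0$ is defined by $Z([A])\in\mathbb R_{>0}e^{i\pi\phi(A)}$. A nonzero object $A$ is semistable (respectively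 stable) if $\phi(A')\le\phi(A)$ (respectively $\phi(A')<\phi(A)$) for every nonzero proper subobject $A'\subset A$. The Harder–Narasimhan filtration of $A\ne0$ is the unique finite filtration $0=A_0\subset A_1\subset\dots\subset A_d=A$ whose factors $A_t/A_{t-1}$ are semistable of strictly decreasing phase, and these factors are the Harder–Narasimhan factors of $A$. Then the following are equivalent: (i) $\mathcal A$ is highest weight with respect to the given ordering, i.e. $\mathrm{End}_{\mathcal A}(\Delta_i)\cong k$ and $P_i$ lies in the extension closure $\langle\Delta_i,\dots,\Delta_n\rangle$ for each $i=1,\dots,n$; (ii) $[\Delta_i:S_i]=1$ and $[P_i]=\sum_{j=i}^n[\nabla_j:S_i]\,[\Delta_j]$ for each $i=1,\dots,n$; (iii) there is a stability function $Z\colon K(\mathcal A)\to\mathbb C$ such that (a) $\Delta_1,\dots,\Delta_n$ are stable with $\phi(\Delta_1)<\dots<\phi(\Delta_n)$, and (b) for each $i=1,\dots,n$, every Harder–Narasimhan factor of $P_i$ is isomorphic to a finite direct sum of copies of the objects $\Delta_i,\dots,\Delta_n$. -/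

import Mathlib

open CategoryTheory CategoryTheory.Limits

universe w v u

namespace HighestWeight

section Basic

variable {C : Type u} [Category.{v} C] [Abelian C]

/-- A `k`-linear abelian category is Deligne finite if it is `Hom`- and `Ext¹`-finite, Noetherian
and Artinian, has finitely many simple objects up to isomorphism, and has enough projectives. -/
structure IsDeligneFinite (k : Type w) [Field k] (C : Type u) [Category.{v} C] [Abelian C]
    [Linear k C] : Prop where
  hom_finite : ∀ X Y : C, Module.Finite k (X ⟶ Y)
  ext_one_finite : haveI : HasExt.{max u v} C := HasExt.standard C
    ∀ X Y : C, Module.Finite k (Abelian.Ext.{max u v} X Y 1)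
  noetherian : ∀ X : C, IsNoetherianObject X
  artinian : ∀ X : C, IsArtinianObject X
  finite_simples : ∃ (m : ℕ) (T : Fin m → C), ∀ X : C, Simple X → ∃ a, Nonempty (X ≅ T a)
  enough_projectives : EnoughProjectives C

/-- `S 0, …, S (n - 1)` is a complete list, without repetition, of representatives of the
isomorphism classes of simple objects; the order of `Fin n` is the chosen ordering. -/
structure IsSimpleList {n : ℕ} (S : Fin n → C) : Prop where
  simple : ∀ i, Simple (S i)
  eq_of_iso : ∀ i j, Nonempty (S i ≅ S j) → i = j
  complete : ∀ X : C, Simple X → ∃ i, Nonempty (X ≅ S i)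

/-- `π : P ⟶ X` is a projective cover: `P` is projective and `π` is an essential epimorphism. -/
structure IsProjectiveCover {P X : C} (π : P ⟶ X) : Prop where
  projective : Projective P
  epi : Epi π
  essential : ∀ ⦃Y : C⦄ (g : Y ⟶ P), Epi (g ≫ π) → Epi g

/-- `ι : X ⟶ I` is an injective hull: `I` is injective and `ι` is an essential monomorphism. -/
structure IsInjectiveHull {X I : C} (ι : X ⟶ I) : Prop where
  injective : Injective I
  mono : Mono ι
  essential : ∀ ⦃Y : C⦄ (g : I ⟶ Y), Mono (ι ≫ g) → Mono g

/-- The extension closure `⟨Q⟩` of a class `Q` of objects: the smallest class of objects that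
contains `Q` and the zero objects and is closed under extensions. It is closed under isomorphisms,
as an isomorphism is an extension of a zero object. -/
inductive ExtensionClosure (Q : ObjectProperty C) : ObjectProperty C
  | of (X : C) : Q X → ExtensionClosure Q X
  | zero (X : C) : IsZero X → ExtensionClosure Q X
  | extension (T : ShortComplex C) : T.ShortExact → ExtensionClosure Q T.X₁ →
      ExtensionClosure Q T.X₃ → ExtensionClosure Q T.X₂

/-- The subcategory `𝒜_i = ⟨S_j | j ≤ i⟩`. -/
def SerreUpTo {n : ℕ} (S : Fin n → C) (i : Fin n) : ObjectProperty C :=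
  ExtensionClosure fun X => ∃ j, j ≤ i ∧ Nonempty (X ≅ S j)

/-- `q : P ⟶ D` is the maximal (that is, greatest) quotient of `P` lying in `Q`. -/
structure IsMaximalQuotient (Q : ObjectProperty C) {P D : C} (q : P ⟶ D) : Prop where
  epi : Epi q
  mem : Q D
  maximal : ∀ ⦃Y : C⦄ (f : P ⟶ Y), Epi f → Q Y → ∃ g : D ⟶ Y, q ≫ g = f

/-- `e : D ⟶ I` is the maximal (that is, greatest) subobject of `I` lying in `Q`. -/
structure IsMaximalSubobject (Q : ObjectProperty C) {D I : C} (e : D ⟶ I) : Prop where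
  mono : Mono e
  mem : Q D
  maximal : ∀ ⦃Y : C⦄ (f : Y ⟶ I), Mono f → Q Y → ∃ g : Y ⟶ D, g ≫ e = f

/-- A finite filtration `0 = A_0 ⊆ A_1 ⊆ ⋯ ⊆ A_d = A` by subobjects. -/
structure Filtration (A : C) where
  length : ℕ
  obj : Fin (length + 1) → Subobject A
  mono : Monotone obj
  obj_zero : obj 0 = ⊥
  obj_last : obj (Fin.last length) = ⊤

/-- The `t`-th factor `A_{t+1} / A_t`. -/
noncomputable def Filtration.factor {A : C} (F : Filtration A) (t : Fin F.length) : C :=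
  cokernel ((F.obj t.castSucc).ofLE (F.obj t.succ) (F.mono (Fin.castSucc_le_succ t)))

/-- A Jordan–Hölder filtration: all factors are simple. -/
def Filtration.IsJordanHolder {A : C} (F : Filtration A) : Prop :=
  ∀ t, Simple (F.factor t)

open Classical in
/-- The number of factors isomorphic to `X`. -/
noncomputable def Filtration.count {A : C} (F : Filtration A) (X : C) : ℕ :=
  (Finset.univ.filter fun t => Nonempty (F.factor t ≅ X)).card

open Classical in
/-- The multiplicity `[A : X]` of the simple object `X` in a Jordan–Hölder filtration of `A`.
Such a filtration exists for every object of a length category, and the multiplicity does not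
depend on its choice, by the Jordan–Hölder theorem. -/
noncomputable def multiplicity (A X : C) : ℕ :=
  if h : ∃ F : Filtration A, F.IsJordanHolder then h.choose.count X else 0

end Basic

section Grothendieck

variable (C : Type u) [Category.{v} C] [Abelian C]

/-- The relations `[T.X₂] = [T.X₁] + [T.X₃]` for short exact sequences `T`. -/
def grothendieckRelations : AddSubgroup (FreeAbelianGroup C) :=
  AddSubgroup.closure {x | ∃ T : ShortComplex C, T.ShortExact ∧
    x = FreeAbelianGroup.of T.X₂ - FreeAbelianGroup.of T.X₁ - FreeAbelianGroup.of T.X₃}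

/-- The Grothendieck group `K(𝒜)`. -/
abbrev GrothendieckGroup : Type u := FreeAbelianGroup C ⧸ grothendieckRelations C

variable {C} in
/-- The class `[A]` of `A` in the Grothendieck group. -/
def cls (A : C) : GrothendieckGroup C := QuotientAddGroup.mk (FreeAbelianGroup.of A)

/-- The set `{r e^{iπφ} | r > 0, φ ∈ (0, 1]}`. -/
def upperHalf : Set ℂ :=
  {z | ∃ r φ : ℝ, 0 < r ∧ 0 < φ ∧ φ ≤ 1 ∧ z = r * Complex.exp (Complex.I * Real.pi * φ)}

/-- A stability function: an additive map `Z : K(𝒜) → ℂ` that sends the class of every nonzero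
object into `upperHalf`. -/
structure StabilityFunction where
  Z : GrothendieckGroup C →+ ℂ
  mem_upperHalf : ∀ A : C, ¬ IsZero A → Z (cls A) ∈ upperHalf

variable {C}

/-- The phase of an object; see `phase_spec` and `phase_unique`. -/
noncomputable def StabilityFunction.phase (σ : StabilityFunction C) (A : C) : ℝ :=
  Complex.arg (σ.Z (cls A)) / Real.pi

/-- `φ` is determined by `r e^{iπφ}` for `r > 0` and `φ ∈ (0, 1]`. -/
theorem StabilityFunction.phase_unique (σ : StabilityFunction C) (A : C) (r φ : ℝ) (hr : 0 < r)
    (h0 : 0 < φ) (h1 : φ ≤ 1)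
    (h : σ.Z (cls A) = r * Complex.exp (Complex.I * Real.pi * φ)) : σ.phase A = φ := by
  have hpi := Real.pi_pos
  have e : Complex.I * Real.pi * φ = ((Real.pi * φ : ℝ) : ℂ) * Complex.I := by
    push_cast; ring
  rw [StabilityFunction.phase, h, e, Complex.arg_real_mul _ hr, Complex.arg_exp_mul_I,
    (toIocMod_eq_self _).2]
  · field_simp
  · constructor
    · nlinarith
    · nlinarith

theorem StabilityFunction.phase_spec (σ : StabilityFunction C) (A : C) (hA : ¬ IsZero A) :
    0 < σ.phase A ∧ σ.phase A ≤ 1 ∧ ∃ r : ℝ, 0 < r ∧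
      σ.Z (cls A) = r * Complex.exp (Complex.I * Real.pi * σ.phase A) := by
  obtain ⟨r, φ, hr, h0, h1, h⟩ := σ.mem_upperHalf A hA
  rw [σ.phase_unique A r φ hr h0 h1 h]
  exact ⟨h0, h1, r, hr, h⟩

/-- `A` is semistable: it is nonzero and `φ(A') ≤ φ(A)` for every nonzero proper subobject `A'`. -/
def StabilityFunction.IsSemistable (σ : StabilityFunction C) (A : C) : Prop :=
  ¬ IsZero A ∧ ∀ B : Subobject A, B ≠ ⊥ → B ≠ ⊤ → σ.phase (B : C) ≤ σ.phase A

/-- `A` is stable: it is nonzero and `φ(A') < φ(A)` for every nonzero proper subobject `A'`. -/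
def StabilityFunction.IsStable (σ : StabilityFunction C) (A : C) : Prop :=
  ¬ IsZero A ∧ ∀ B : Subobject A, B ≠ ⊥ → B ≠ ⊤ → σ.phase (B : C) < σ.phase A

/-- A Harder–Narasimhan filtration: the factors are semistable, of strictly decreasing phase. -/
def StabilityFunction.IsHarderNarasimhan (σ : StabilityFunction C) {A : C} (F : Filtration A) :
    Prop :=
  (∀ t, σ.IsSemistable (F.factor t)) ∧ StrictAnti fun t => σ.phase (F.factor t)

attribute [local instance] Abelian.hasFiniteBiproducts in
/-- `X` is isomorphic to a finite direct sum of objects `Δ j` with `i ≤ j`, where repetitions are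
allowed. -/
def IsDirectSumFrom {n : ℕ} (Δ : Fin n → C) (i : Fin n) (X : C) : Prop :=
  ∃ (m : ℕ) (c : Fin m → Fin n), (∀ a, i ≤ c a) ∧ Nonempty (X ≅ ⨁ fun a => Δ (c a))

end Grothendieck

/-- The highest weight condition on the projective covers `P i` and standard objects `Δ i`:
`End(Δ_i) ≅ k` and `P_i ∈ ⟨Δ_i, …, Δ_n⟩` for every `i`. -/
def IsHighestWeight (k : Type w) [Field k] {C : Type u} [Category.{v} C] [Abelian C]
    [Linear k C] {n : ℕ} (P Δ : Fin n → C) : Prop :=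
  ∀ i, Nonempty (End (Δ i) ≃ₐ[k] k) ∧
    ExtensionClosure (fun X => ∃ j, i ≤ j ∧ Nonempty (X ≅ Δ j)) (P i)

end HighestWeight

/-! Everything is measured by the additive functions $d_i(X)=\dim\mathrm{Hom}(P_i,X)$. They are dual
to the simple objects, so they compute $[X:S_i]$, they equal $\dim\mathrm{Hom}(X,I_i)$, and
$X\in\mathcal A_i$ exactly when $d_l(X)=0$ for all $l>i$.

(i) ⇒ (ii): inside $\mathcal A_a$ the object $\Delta_a$ behaves as a projective and $\nabla_a$ as an
injective. Hence $\mathrm{Ext}^1(\Delta_a,\nabla_b)=0$ (`extVanishes_standard_costandard`) and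
$\dim\mathrm{Hom}(\Delta_a,\nabla_b)=\delta_{ab}$ (`finrank_standard_costandard`). So
$\mathrm{Hom}(-,\nabla_j)$ counts the copies of $\Delta_j$ in any object filtered by standard
objects; for $P_i$ this count is $[\nabla_j:S_i]$.

(ii) ⇒ (iii): let $t_j\subseteq P_i$ be the trace of the $P_l$ with $l\ge j$. The quotient
$t_j/t_{j+1}$ is an image of $\Delta_j^{m_j}$ with $m_j=[\nabla_j:S_i]$. Comparing lengths with the
identity for $[P_i]$ forces all these surjections to be isomorphisms (`exists_standard_filtration`).
A stability function that weights $S_l$ by a large power $b^l$ makes the $\Delta_j$ stable of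
increasing phase (`exists_stabilityFunction`), and the trace chain without repetitions is then the
Harder–Narasimhan filtration.

(iii) ⇒ (i): a stable object satisfies Schur's lemma, so its endomorphism algebra is $k$; a
filtration whose factors are sums of standard objects puts $P_i$ in their extension closure. -/

namespace HighestWeight

/-! ### Additive functions on objects and dimensions of Hom spaces -/

section Additive

variable {C : Type u} [Category.{v} C] [Abelian C]

/-- A function on objects that is additive on short exact sequences. -/
def IsAdditive (d : C → ℕ) : Prop :=
  ∀ T : ShortComplex C, T.ShortExact → d T.X₂ = d T.X₁ + d T.X₃

theorem shortExact_cokernel {X Y : C} (f : X ⟶ Y) [Mono f] :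
    (ShortComplex.mk f (cokernel.π f) (cokernel.condition f)).ShortExact :=
  { exact := ShortComplex.exact_of_g_is_cokernel _ (cokernelIsCokernel f)
    mono_f := ‹_›
    epi_g := inferInstance }

theorem shortExact_kernel {X Y : C} (f : X ⟶ Y) [Epi f] :
    (ShortComplex.mk (kernel.ι f) f (kernel.condition f)).ShortExact :=
  { exact := ShortComplex.exact_of_f_is_kernel _ (kernelIsKernel f)
    mono_f := inferInstance
    epi_g := ‹_› }

theorem isZero_of_forall_eq_zero {X Y : C} (f : X ⟶ Y) [Epi f] (h : f = 0) : IsZero Y :=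
  (IsZero.iff_id_eq_zero Y).2 (by rw [← cancel_epi f, h]; simp)

theorem isZero_of_mono_eq_zero {X Y : C} (f : X ⟶ Y) [Mono f] (h : f = 0) : IsZero X :=
  (IsZero.iff_id_eq_zero X).2 (by rw [← cancel_mono f, h]; simp)

namespace IsAdditive

variable {d : C → ℕ} (hd : IsAdditive d)
include hd

theorem mono {X Y : C} (f : X ⟶ Y) [Mono f] : d Y = d X + d (cokernel f) :=
  hd _ (shortExact_cokernel f)

theorem epi {X Y : C} (f : X ⟶ Y) [Epi f] : d X = d (kernel f) + d Y :=
  hd _ (shortExact_kernel f)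

theorem eq_zero {X : C} (h : IsZero X) : d X = 0 := by
  have := hd (ShortComplex.mk (0 : X ⟶ X) (0 : X ⟶ X) (by simp))
    { exact := ShortComplex.exact_of_isZero_X₂ _ h
      mono_f := ⟨fun _ _ _ => h.eq_of_tgt _ _⟩
      epi_g := ⟨fun _ _ _ => h.eq_of_src _ _⟩ }
  simpa using this

theorem iso {X Y : C} (f : X ≅ Y) : d X = d Y := by
  have := hd.mono f.hom
  rw [hd.eq_zero (isZero_cokernel_of_epi f.hom)] at this
  omega

theorem le_of_mono {X Y : C} (f : X ⟶ Y) [Mono f] : d X ≤ d Y := by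
  have := hd.mono f; omega

theorem le_of_epi {X Y : C} (f : X ⟶ Y) [Epi f] : d Y ≤ d X := by
  have := hd.epi f; omega

/-- Two additive functions agreeing on `Q` agree on its extension closure. -/
theorem eq_of_extensionClosure {d' : C → ℕ} (hd' : IsAdditive d') {Q : ObjectProperty C}
    (h : ∀ X, Q X → d X = d' X) {X : C} (hX : ExtensionClosure Q X) : d X = d' X := by
  induction hX with
  | of X hX => exact h X hX
  | zero X hX => rw [hd.eq_zero hX, hd'.eq_zero hX]
  | extension T hT _ _ h₁ h₃ => rw [hd T hT, hd' T hT, h₁, h₃]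

end IsAdditive

theorem isAdditive_sum {ι : Type*} (s : Finset ι) (d : ι → C → ℕ) (hd : ∀ i, IsAdditive (d i)) :
    IsAdditive fun X => ∑ i ∈ s, d i X := fun T hT => by
  simp only [← Finset.sum_add_distrib]
  exact Finset.sum_congr rfl fun i _ => hd i T hT

variable {k : Type w} [Field k]

theorem finrank_eq_add_of_exact {U V W : Type*} [AddCommGroup U] [Module k U] [AddCommGroup V]
    [Module k V] [AddCommGroup W] [Module k W] [Module.Finite k V] (f : U →ₗ[k] V) (g : V →ₗ[k] W)
    (hf : Function.Injective f) (h : Function.Exact f g) (hg : Function.Surjective g) :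
    Module.finrank k V = Module.finrank k U + Module.finrank k W := by
  rw [← LinearMap.finrank_range_add_finrank_ker g, LinearMap.range_eq_top.2 hg,
    LinearMap.exact_iff.1 h, LinearMap.finrank_range_of_inj hf, finrank_top, add_comm]

variable [Linear k C] [∀ X Y : C, Module.Finite k (X ⟶ Y)]

theorem isAdditive_finrank_hom_from (P : C) [Projective P] :
    IsAdditive fun X : C => Module.finrank k (P ⟶ X) := fun T hT => by
  have := hT.mono_f
  have := hT.epi_g
  refine finrank_eq_add_of_exact (Linear.rightComp k P T.f) (Linear.rightComp k P T.g) ?_ ?_ ?_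
  · intro a b h
    exact (cancel_mono T.f).1 h
  · intro a
    constructor
    · intro h
      exact ⟨hT.exact.lift a h, hT.exact.lift_f a h⟩
    · rintro ⟨b, rfl⟩
      simp
  · intro a
    exact ⟨Projective.factorThru a T.g, Projective.factorThru_comp a T.g⟩

/-- Only surjectivity of restriction to `T.X₁` is needed; asking for that instead of injectivity of
`N` lets the lemma serve costandard objects too. -/
theorem finrank_hom_to_eq_add (N : C) {T : ShortComplex C} (hT : T.ShortExact)
    (h : ∀ g : T.X₁ ⟶ N, ∃ g' : T.X₂ ⟶ N, T.f ≫ g' = g) :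
    Module.finrank k (T.X₂ ⟶ N) = Module.finrank k (T.X₁ ⟶ N) + Module.finrank k (T.X₃ ⟶ N) := by
  have := hT.mono_f
  have := hT.epi_g
  rw [add_comm]
  refine finrank_eq_add_of_exact (Linear.leftComp k N T.g) (Linear.leftComp k N T.f) ?_ ?_ h
  · intro a b h
    exact (cancel_epi T.g).1 h
  · intro a
    constructor
    · intro h
      exact ⟨hT.exact.desc a h, hT.exact.g_desc a h⟩
    · rintro ⟨b, rfl⟩
      simp

theorem isAdditive_finrank_hom_to (I : C) [Injective I] :
    IsAdditive fun X : C => Module.finrank k (X ⟶ I) := fun T hT => by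
  have := hT.mono_f
  exact finrank_hom_to_eq_add I hT fun g =>
    ⟨Injective.factorThru g T.f, Injective.comp_factorThru g T.f⟩

end Additive

/-! ### Projective covers and injective hulls of simple objects -/

section SimpleMultiplicity

variable {C : Type u} [Category.{v} C] [Abelian C]

/-- If $\ker f$ were not killed by `π`, it would surject onto `S`, so by essentiality its inclusion
would be epi and `f` would vanish. Hence `π` factors through `f`, and Schur's lemma applies. -/
theorem IsProjectiveCover.iso_of_ne_zero {P S S' : C} [Simple S] [Simple S'] {π : P ⟶ S}
    (h : IsProjectiveCover π) (f : P ⟶ S') (hf : f ≠ 0) : ∃ i : S' ≅ S, π = f ≫ i.hom := by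
  have := h.epi
  have : Epi f := epi_of_nonzero_to_simple hf
  have h0 : kernel.ι f ≫ π = 0 := by
    by_contra h0
    have := h.essential (kernel.ι f) (epi_of_nonzero_to_simple h0)
    exact hf (by rw [← cancel_epi (kernel.ι f), kernel.condition, comp_zero])
  let g : S' ⟶ S := (shortExact_kernel f).exact.desc π h0
  have hg : f ≫ g = π := (shortExact_kernel f).exact.g_desc π h0
  have hπ : π ≠ 0 := fun h0 =>
    id_nonzero S ((IsZero.iff_id_eq_zero S).1 (isZero_of_forall_eq_zero π h0))
  have : IsIso g := isIso_of_hom_simple fun h0 => hπ (by rw [← hg, h0, comp_zero])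
  exact ⟨asIso g, hg.symm⟩

theorem IsInjectiveHull.iso_of_ne_zero {I S S' : C} [Simple S] [Simple S'] {ι : S ⟶ I}
    (h : IsInjectiveHull ι) (f : S' ⟶ I) (hf : f ≠ 0) : ∃ i : S ≅ S', ι = i.hom ≫ f := by
  have := h.mono
  have : Mono f := mono_of_nonzero_from_simple hf
  have h0 : ι ≫ cokernel.π f = 0 := by
    by_contra h0
    have := h.essential (cokernel.π f) (mono_of_nonzero_from_simple h0)
    exact hf (by rw [← cancel_mono (cokernel.π f), cokernel.condition, zero_comp])
  let g : S ⟶ S' := (shortExact_cokernel f).exact.lift ι h0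
  have hg : g ≫ f = ι := (shortExact_cokernel f).exact.lift_f ι h0
  have hι : ι ≠ 0 := fun h0 =>
    id_nonzero S ((IsZero.iff_id_eq_zero S).1 (isZero_of_mono_eq_zero ι h0))
  have : IsIso g := isIso_of_hom_simple fun h0 => hι (by rw [← hg, h0, zero_comp])
  exact ⟨asIso g, hg.symm⟩

variable {k : Type w} [Field k] [IsAlgClosed k] [Linear k C] [∀ X Y : C, Module.Finite k (X ⟶ Y)]

theorem IsProjectiveCover.finrank_self {P S : C} [Simple S] {π : P ⟶ S} (h : IsProjectiveCover π) :
    Module.finrank k (P ⟶ S) = 1 := by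
  have := h.epi
  have hπ : π ≠ 0 := fun h0 =>
    id_nonzero S ((IsZero.iff_id_eq_zero S).1 (isZero_of_forall_eq_zero π h0))
  rw [← finrank_endomorphism_simple_eq_one k S]
  refine (LinearEquiv.finrank_eq (LinearEquiv.ofBijective (Linear.leftComp k S π) ⟨?_, ?_⟩)).symm
  · intro a b hab
    exact (cancel_epi π).1 hab
  · intro f
    by_cases hf : f = 0
    · exact ⟨0, by simp [hf]⟩
    · obtain ⟨i, hi⟩ := h.iso_of_ne_zero f hf
      exact ⟨i.inv, by simp [hi]⟩

theorem IsInjectiveHull.finrank_self {I S : C} [Simple S] {ι : S ⟶ I} (h : IsInjectiveHull ι) :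
    Module.finrank k (S ⟶ I) = 1 := by
  have := h.mono
  have hι : ι ≠ 0 := fun h0 =>
    id_nonzero S ((IsZero.iff_id_eq_zero S).1 (isZero_of_mono_eq_zero ι h0))
  rw [← finrank_endomorphism_simple_eq_one k S]
  refine (LinearEquiv.finrank_eq (LinearEquiv.ofBijective (Linear.rightComp k S ι) ⟨?_, ?_⟩)).symm
  · intro a b hab
    exact (cancel_mono ι).1 hab
  · intro f
    by_cases hf : f = 0
    · exact ⟨0, by simp [hf]⟩
    · obtain ⟨i, hi⟩ := h.iso_of_ne_zero f hf
      exact ⟨i.inv, by simp [hi]⟩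

variable {n : ℕ} {S : Fin n → C} (hS : IsSimpleList S)
include hS

theorem IsSimpleList.finrank_projectiveCover {P : Fin n → C} {π : ∀ i, P i ⟶ S i}
    (hπ : ∀ i, IsProjectiveCover (π i)) (i j : Fin n) :
    Module.finrank k (P i ⟶ S j) = if i = j then 1 else 0 := by
  have := hS.simple
  split_ifs with h
  · subst h
    exact (hπ i).finrank_self
  · have : Subsingleton (P i ⟶ S j) := subsingleton_of_forall_eq 0 fun f => by
      by_contra hf
      obtain ⟨e, -⟩ := (hπ i).iso_of_ne_zero f hf
      exact h (hS.eq_of_iso _ _ ⟨e.symm⟩)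
    exact Module.finrank_zero_of_subsingleton

theorem IsSimpleList.finrank_injectiveHull {I : Fin n → C} {ι : ∀ i, S i ⟶ I i}
    (hι : ∀ i, IsInjectiveHull (ι i)) (i j : Fin n) :
    Module.finrank k (S j ⟶ I i) = if i = j then 1 else 0 := by
  have := hS.simple
  split_ifs with h
  · subst h
    exact (hι i).finrank_self
  · have : Subsingleton (S j ⟶ I i) := subsingleton_of_forall_eq 0 fun f => by
      by_contra hf
      obtain ⟨e, -⟩ := (hι i).iso_of_ne_zero f hf
      exact h (hS.eq_of_iso _ _ ⟨e⟩)
    exact Module.finrank_zero_of_subsingleton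

end SimpleMultiplicity

end HighestWeight

namespace HighestWeight

/-! ### Multiplicity functions and the subcategories $\mathcal A_i$ -/

section Multiplicity

variable {C : Type u} [Category.{v} C] [Abelian C] {n : ℕ}

/-- A family of additive functions dual to the list of simple objects. -/
structure IsMultiplicity (S : Fin n → C) (d : Fin n → C → ℕ) : Prop where
  additive : ∀ i, IsAdditive (d i)
  simple : ∀ i j, d i (S j) = if i = j then 1 else 0

/-- The length of an object in terms of multiplicities. -/
def totalMult (d : Fin n → C → ℕ) (X : C) : ℕ := ∑ i, d i X

variable {S : Fin n → C} {d : Fin n → C → ℕ} (hS : IsSimpleList S) (hd : IsMultiplicity S d)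

include hd in
theorem IsMultiplicity.isAdditive_totalMult : IsAdditive (totalMult d) :=
  isAdditive_sum Finset.univ d hd.additive

include hd in
theorem IsMultiplicity.totalMult_simple (j : Fin n) : totalMult d (S j) = 1 := by
  simp [totalMult, hd.simple]

variable [∀ X : C, IsArtinianObject X]

include hS in
theorem IsSimpleList.exists_mono {X : C} (hX : ¬ IsZero X) :
    ∃ (j : Fin n) (f : S j ⟶ X), Mono f := by
  obtain ⟨Y, hY⟩ := exists_simple_subobject hX
  obtain ⟨j, ⟨e⟩⟩ := hS.complete _ hY
  exact ⟨j, e.inv ≫ Y.arrow, inferInstance⟩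

include hS hd in
theorem IsMultiplicity.isZero_of_totalMult {X : C} (h : totalMult d X = 0) : IsZero X := by
  by_contra hX
  obtain ⟨j, f, hf⟩ := hS.exists_mono hX
  have := hd.isAdditive_totalMult.le_of_mono f
  rw [hd.totalMult_simple] at this
  omega

include hS hd in
theorem IsMultiplicity.isZero_of_forall {X : C} (h : ∀ i, d i X = 0) : IsZero X :=
  hd.isZero_of_totalMult hS (by simp [totalMult, h])

include hS hd in
-- Induction on length, splitting off a simple subobject, whose index must lie in `J`.
theorem IsMultiplicity.extensionClosure (J : Set (Fin n)) {X : C} (h : ∀ l, l ∉ J → d l X = 0) :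
    ExtensionClosure (fun X => ∃ j, j ∈ J ∧ Nonempty (X ≅ S j)) X := by
  induction hm : totalMult d X using Nat.strong_induction_on generalizing X with
  | _ m ih =>
    by_cases hX : IsZero X
    · exact .zero X hX
    obtain ⟨j, f, hf⟩ := hS.exists_mono hX
    have hj : j ∈ J := by
      by_contra hj
      have := (hd.additive j).le_of_mono f
      rw [h j hj, hd.simple, if_pos rfl] at this
      omega
    have hlt : totalMult d (cokernel f) < m := by
      have := hd.isAdditive_totalMult.mono f
      rw [hd.totalMult_simple] at this
      omega
    refine .extension _ (shortExact_cokernel f) (.of _ ⟨j, hj, ⟨Iso.refl _⟩⟩) (ih _ hlt ?_ rfl)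
    intro l hl
    exact Nat.eq_zero_of_le_zero (((hd.additive l).le_of_epi (cokernel.π f)).trans (h l hl).le)

include hS hd in
-- This numerical criterion is what makes $\mathcal A_i$ visibly closed under subobjects and
-- quotients.
theorem IsMultiplicity.serreUpTo_iff (i : Fin n) (X : C) :
    SerreUpTo S i X ↔ ∀ l, i < l → d l X = 0 := by
  constructor
  · intro hX l hl
    refine (hd.additive l).eq_of_extensionClosure (d' := fun _ => 0) (fun _ _ => rfl) ?_ hX
    rintro X ⟨j, hj, ⟨e⟩⟩
    rw [(hd.additive l).iso e, hd.simple, if_neg (by rintro rfl; exact absurd hl (not_lt.2 hj))]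
  · intro h
    exact hd.extensionClosure hS (Set.Iic i) fun l hl => h l (not_le.1 hl)

include hS hd in
-- Every object is an iterated extension of simples, so values on simples determine an additive
-- function. This is how $\mathrm{Hom}(-,I_i)$ is compared with $\mathrm{Hom}(P_i,-)$.
theorem IsMultiplicity.eq_of_simple {i : Fin n} {d' : C → ℕ} (hd' : IsAdditive d')
    (h : ∀ j, d' (S j) = if i = j then 1 else 0) (X : C) : d' X = d i X := by
  refine hd'.eq_of_extensionClosure (hd.additive i) ?_
    (hd.extensionClosure hS Set.univ (X := X) fun l hl => absurd (Set.mem_univ l) hl)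
  rintro X ⟨j, -, ⟨e⟩⟩
  rw [hd'.iso e, (hd.additive i).iso e, h, hd.simple]

end Multiplicity

/-! ### Filtrations and Jordan–Hölder multiplicities -/

section Filtration

variable {C : Type u} [Category.{v} C] [Abelian C]

/-- The filtration given by an initial segment of a sequence of subobjects. -/
def Filtration.ofSeq {A : C} (m : ℕ) (a : ℕ → Subobject A) (h0 : a 0 = ⊥) (hm : a m = ⊤)
    (h : ∀ l, l < m → a l ≤ a (l + 1)) : Filtration A where
  length := m
  obj t := a t
  mono := Fin.monotone_iff_le_succ.2 fun t => h t t.2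
  obj_zero := h0
  obj_last := hm

theorem sum_of_succ_eq {m : ℕ} (g : Fin (m + 1) → ℕ) (h : Fin m → ℕ)
    (hg : ∀ t, g t.succ = g t.castSucc + h t) : g (Fin.last m) = g 0 + ∑ t, h t := by
  induction m with
  | zero => simp
  | succ m ih =>
    rw [Fin.sum_univ_castSucc, ← Fin.succ_last, hg, ih (fun t => g t.castSucc) fun t => h t.castSucc]
    · simp [add_assoc]
    · intro t
      exact hg t.castSucc

theorem isZero_bot (A : C) : IsZero ((⊥ : Subobject A) : C) :=
  (isZero_zero C).of_iso Subobject.botCoeIsoZero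

theorem IsAdditive.sum_factor {d : C → ℕ} (hd : IsAdditive d) {A : C} (F : Filtration A) :
    d A = ∑ t, d (F.factor t) := by
  have h := sum_of_succ_eq (fun t => d (F.obj t : C)) (fun t => d (F.factor t))
    fun t => hd.mono ((F.obj t.castSucc).ofLE (F.obj t.succ) (F.mono (Fin.castSucc_le_succ t)))
  simp only [F.obj_zero, F.obj_last, hd.eq_zero (isZero_bot A), zero_add] at h
  rw [← h]
  exact (hd.iso (asIso (⊤ : Subobject A).arrow)).symm

theorem ExtensionClosure.iso {Q : ObjectProperty C} {X Y : C} (h : ExtensionClosure Q X)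
    (e : X ≅ Y) : ExtensionClosure Q Y :=
  .extension _ (shortExact_cokernel e.hom) h (.zero _ (isZero_cokernel_of_epi e.hom))

theorem extensionClosure_of_filtration {Q : ObjectProperty C} {A : C} (F : Filtration A)
    (h : ∀ t, ExtensionClosure Q (F.factor t)) : ExtensionClosure Q A := by
  have key : ∀ t, ExtensionClosure Q (F.obj t : C) := by
    intro t
    induction t using Fin.induction with
    | zero => rw [F.obj_zero]; exact .zero _ (isZero_bot A)
    | succ t ih =>
      exact .extension _ (shortExact_cokernel ((F.obj t.castSucc).ofLE (F.obj t.succ)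
        (F.mono (Fin.castSucc_le_succ t)))) ih (h t)
  have h1 := key (Fin.last _)
  rw [F.obj_last] at h1
  exact h1.iso (asIso (⊤ : Subobject A).arrow)

variable {n : ℕ} {S : Fin n → C} {d : Fin n → C → ℕ} (hS : IsSimpleList S)
  (hd : IsMultiplicity S d) [∀ X : C, IsArtinianObject X]

include hS hd

theorem IsMultiplicity.isIso_of_mono {X Y : C} (f : X ⟶ Y) [Mono f]
    (h : totalMult d Y ≤ totalMult d X) : IsIso f := by
  have h1 := hd.isAdditive_totalMult.mono f
  have : Epi f := Preadditive.epi_of_isZero_cokernel f (hd.isZero_of_totalMult hS (by omega))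
  exact isIso_of_mono_of_epi f

theorem IsMultiplicity.isIso_of_epi {X Y : C} (f : X ⟶ Y) [Epi f]
    (h : totalMult d X ≤ totalMult d Y) : IsIso f := by
  have h1 := hd.isAdditive_totalMult.epi f
  have : Mono f := Preadditive.mono_of_isZero_kernel f (hd.isZero_of_totalMult hS (by omega))
  exact isIso_of_mono_of_epi f

theorem IsMultiplicity.simple_cokernel_of_covBy {A : C} {x y : Subobject A} (h : x ⋖ y) :
    Simple (cokernel (x.ofLE y h.le)) := by
  have hl := hd.isAdditive_totalMult
  have hxy := hl.mono (x.ofLE y h.le)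
  refine ⟨fun {Z} i hi => ⟨fun hiso h0 => ?_, fun h0 => ?_⟩⟩
  · subst h0
    have : IsZero (cokernel (x.ofLE y h.le)) := isZero_of_forall_eq_zero (0 : Z ⟶ _) rfl
    rw [hl.eq_zero this] at hxy
    have := hd.isIso_of_mono hS (x.ofLE y h.le) (by omega)
    refine h.lt.not_ge (Subobject.le_of_comm (inv (x.ofLE y h.le)) ?_)
    rw [IsIso.inv_comp_eq, Subobject.ofLE_arrow]
  -- The kernel of `p` is the preimage in `y` of the subobject `Z` of $y/x$. It lies between `x` and
  -- `y`, so it equals one of them, and lengths decide whether `Z` is zero or everything.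
  · let p := cokernel.π (x.ofLE y h.le) ≫ cokernel.π i
    let z : Subobject A := Subobject.mk (kernel.ι p ≫ y.arrow)
    have hzy : z ≤ y := Subobject.mk_le_of_comm (kernel.ι p) rfl
    have hxz : x ≤ z := Subobject.le_mk_of_comm
      (kernel.lift p (x.ofLE y h.le) (by simp [p])) (by simp)
    have hz : totalMult d (z : C) = totalMult d (kernel p) :=
      hl.iso (Subobject.underlyingIso (kernel.ι p ≫ y.arrow))
    have hp := hl.epi p
    have hi' := hl.mono i
    rcases h.eq_or_eq hxz hzy with e | e
    · rw [e] at hz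
      exact absurd (hd.isZero_of_totalMult hS (by omega)) fun hZ => h0 (hZ.eq_of_src _ _)
    · rw [e] at hz
      exact hd.isIso_of_mono hS i (by omega)

omit [∀ X : C, IsArtinianObject X] in
theorem IsMultiplicity.count_eq {A : C} {F : Filtration A} (hF : F.IsJordanHolder) (i : Fin n) :
    F.count (S i) = d i A := by
  classical
  rw [(hd.additive i).sum_factor F, Filtration.count, Finset.card_filter]
  refine Finset.sum_congr rfl fun t _ => ?_
  obtain ⟨j, ⟨e⟩⟩ := hS.complete _ (hF t)
  rw [(hd.additive i).iso e, hd.simple]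
  by_cases h : i = j
  · subst h
    rw [if_pos ⟨e⟩, if_pos rfl]
  · rw [if_neg, if_neg h]
    rintro ⟨e'⟩
    exact h (hS.eq_of_iso _ _ ⟨e'.symm ≪≫ e⟩)

variable [∀ X : C, IsNoetherianObject X]

theorem IsMultiplicity.exists_isJordanHolder (A : C) : ∃ F : Filtration A, F.IsJordanHolder := by
  obtain ⟨a, h0, m, hm, ha⟩ := exists_covBy_seq_of_wellFoundedLT_wellFoundedGT (Subobject A)
  refine ⟨.ofSeq m a h0.eq_bot hm.eq_top fun l hl => (ha l hl).le, fun t => ?_⟩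
  exact hd.simple_cokernel_of_covBy hS (ha t t.2)

theorem IsMultiplicity.multiplicity_eq (A : C) (i : Fin n) : multiplicity A (S i) = d i A := by
  have h := hd.exists_isJordanHolder hS A
  rw [multiplicity, dif_pos h]
  exact hd.count_eq hS h.choose_spec i

end Filtration

end HighestWeight

namespace HighestWeight

/-! ### Finite direct sums as iterated extensions -/

section Biproduct

variable {C : Type u} [Category.{v} C] [Abelian C]

attribute [local instance] Abelian.hasFiniteBiproducts

theorem isZero_biproduct_of_isEmpty {ι : Type} [Finite ι] [IsEmpty ι] (f : ι → C) :
    IsZero (⨁ f) :=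
  (IsZero.iff_id_eq_zero _).2 (biproduct.hom_ext _ _ isEmptyElim)

/-- The split exact sequence `f 0 → ⨁ f → ⨁ f ∘ Fin.succ`. -/
noncomputable abbrev biproductSucc {m : ℕ} (f : Fin (m + 1) → C) : ShortComplex C :=
  ShortComplex.mk (biproduct.ι f 0)
    (biproduct.lift (f := fun a : Fin m => f a.succ) fun a => biproduct.π f a.succ)
    (biproduct.hom_ext _ _ fun a => by simp [biproduct.ι_π_ne f (Fin.succ_ne_zero a).symm])

theorem shortExact_biproductSucc {m : ℕ} (f : Fin (m + 1) → C) : (biproductSucc f).ShortExact :=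
  ShortComplex.Splitting.shortExact
    { r := biproduct.π f 0
      s := biproduct.desc fun a => biproduct.ι f a.succ
      f_r := biproduct.ι_π_self f 0
      s_g := by
        ext a b
        by_cases h : a = b
        · subst h; simp
        · simp [biproduct.ι_π_ne _ (Ne.symm h),
            biproduct.ι_π_ne f (fun e => h (Fin.succ_injective _ e).symm)]
      id := by
        apply biproduct.hom_ext'
        intro a
        refine Fin.cases ?_ (fun a => ?_) a
        · rw [Preadditive.comp_add, biproduct.ι_π_self_assoc]
          rw [reassoc_of% (biproductSucc f).zero, zero_comp, add_zero, Category.comp_id]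
        · have : biproduct.ι f a.succ ≫ biproduct.lift (f := fun a : Fin m => f a.succ)
              (fun a => biproduct.π f a.succ) = biproduct.ι (fun a : Fin m => f a.succ) a := by
            ext b
            by_cases h : a = b
            · subst h; simp
            · simp [biproduct.ι_π_ne _ h, biproduct.ι_π_ne f (fun e => h (Fin.succ_injective _ e))]
          rw [Preadditive.comp_add, reassoc_of% this,
            biproduct.ι_π_ne_assoc f (Fin.succ_ne_zero a), zero_comp, zero_add, biproduct.ι_desc,
            Category.comp_id] }

theorem ExtensionClosure.biproduct {Q : ObjectProperty C} {m : ℕ} (f : Fin m → C)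
    (h : ∀ a, Q (f a)) : ExtensionClosure Q (⨁ f) := by
  induction m with
  | zero => exact .zero _ (isZero_biproduct_of_isEmpty f)
  | succ m ih =>
    exact .extension _ (shortExact_biproductSucc f) (.of _ (h 0)) (ih _ fun a => h a.succ)

theorem IsAdditive.biproduct {d : C → ℕ} (hd : IsAdditive d) (X : C) (m : ℕ) :
    d (⨁ fun _ : Fin m => X) = m * d X := by
  induction m with
  | zero => rw [hd.eq_zero (isZero_biproduct_of_isEmpty _), zero_mul]
  | succ m ih =>
    have : d (⨁ fun _ : Fin (m + 1) => X) = d X + d (⨁ fun _ : Fin m => X) :=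
      hd _ (shortExact_biproductSucc fun _ : Fin (m + 1) => X)
    rw [this, ih]
    ring

end Biproduct

/-! ### Classes in the Grothendieck group -/

section Grothendieck

variable {C : Type u} [Category.{v} C] [Abelian C]

theorem cls_eq_add {T : ShortComplex C} (hT : T.ShortExact) :
    cls T.X₂ = cls T.X₁ + cls T.X₃ := by
  have : (QuotientAddGroup.mk (FreeAbelianGroup.of T.X₂ - FreeAbelianGroup.of T.X₁ -
      FreeAbelianGroup.of T.X₃) : GrothendieckGroup C) = 0 :=
    (QuotientAddGroup.eq_zero_iff _).2 (AddSubgroup.subset_closure ⟨T, hT, rfl⟩)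
  rw [sub_sub, QuotientAddGroup.mk_sub, sub_eq_zero] at this
  exact this

theorem cls_eq_zero {X : C} (h : IsZero X) : cls X = 0 := by
  have := cls_eq_add (T := ShortComplex.mk (0 : X ⟶ X) (0 : X ⟶ X) (by simp))
    { exact := ShortComplex.exact_of_isZero_X₂ _ h
      mono_f := ⟨fun _ _ _ => h.eq_of_tgt _ _⟩
      epi_g := ⟨fun _ _ _ => h.eq_of_src _ _⟩ }
  simpa using this

theorem cls_iso {X Y : C} (e : X ≅ Y) : cls X = cls Y := by
  have := cls_eq_add (shortExact_cokernel e.hom)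
  dsimp only at this
  rw [cls_eq_zero (isZero_cokernel_of_epi e.hom), add_zero] at this
  exact this.symm

/-- The map on the Grothendieck group induced by an additive function. -/
def IsAdditive.hom {d : C → ℕ} (hd : IsAdditive d) : GrothendieckGroup C →+ ℤ :=
  QuotientAddGroup.lift _ (FreeAbelianGroup.lift fun X => (d X : ℤ)) (by
    rw [grothendieckRelations, AddSubgroup.closure_le]
    rintro _ ⟨T, hT, rfl⟩
    simp [hd T hT])

@[simp] theorem IsAdditive.hom_cls {d : C → ℕ} (hd : IsAdditive d) (X : C) :
    hd.hom (cls X) = d X :=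
  FreeAbelianGroup.lift_apply_of _ _

end Grothendieck

/-! ### Comparing arguments in the upper half plane -/

section Complex

/-- Twice the signed area of the triangle spanned by `z` and `w`. -/
def cross (z w : ℂ) : ℝ := z.re * w.im - z.im * w.re

theorem cross_add_left (z z' w : ℂ) : cross (z + z') w = cross z w + cross z' w := by
  simp [cross]; ring

theorem cross_self (z : ℂ) : cross z z = 0 := by
  simp [cross]; ring

theorem cross_eq_sin (z w : ℂ) : cross z w = ‖z‖ * ‖w‖ * Real.sin (w.arg - z.arg) := by
  rw [Real.sin_sub, cross]
  linear_combination (-z.re) * Complex.norm_mul_sin_arg w + z.im * Complex.norm_mul_cos_arg w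
    - ‖w‖ * Real.sin w.arg * Complex.norm_mul_cos_arg z
    + ‖w‖ * Real.cos w.arg * Complex.norm_mul_sin_arg z

theorem arg_mem_of_mem_upperHalf {z : ℂ} (h : z ∈ upperHalf) : z ≠ 0 ∧ 0 < z.arg := by
  obtain ⟨r, φ, hr, h0, h1, rfl⟩ := h
  have hpi := Real.pi_pos
  have e : Complex.I * Real.pi * φ = ((Real.pi * φ : ℝ) : ℂ) * Complex.I := by
    push_cast; ring
  refine ⟨mul_ne_zero (by exact_mod_cast hr.ne') (Complex.exp_ne_zero _), ?_⟩
  rw [e, Complex.arg_real_mul _ hr, Complex.arg_exp_mul_I, (toIocMod_eq_self _).2]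
  · positivity
  · constructor <;> nlinarith

theorem mem_upperHalf_of_im_pos {z : ℂ} (h : 0 < z.im) : z ∈ upperHalf := by
  have hz : z ≠ 0 := by rintro rfl; simp at h
  have hpi := Real.pi_pos
  have harg : 0 < z.arg := by
    refine lt_of_le_of_ne (Complex.arg_nonneg_iff.2 h.le) fun h0 => ?_
    exact h.ne' (Complex.arg_eq_zero_iff.1 h0.symm).2
  refine ⟨‖z‖, z.arg / Real.pi, norm_pos_iff.2 hz, by positivity, ?_, ?_⟩
  · rw [div_le_one hpi]; exact Complex.arg_le_pi z
  · have : Complex.I * Real.pi * ((z.arg / Real.pi : ℝ) : ℂ) = z.arg * Complex.I := by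
      push_cast
      field_simp
    rw [this, Complex.norm_mul_exp_arg_mul_I]

/-- Both arguments lie in $(0,\pi]$, so their difference lies in $(-\pi,\pi)$, where sine has the
sign of its argument. Phase comparisons thus become signs of an expression additive in `z`. -/
theorem cross_pos_iff {z w : ℂ} (hz : z ∈ upperHalf) (hw : w ∈ upperHalf) :
    0 < cross z w ↔ z.arg < w.arg := by
  obtain ⟨hz0, hz1⟩ := arg_mem_of_mem_upperHalf hz
  obtain ⟨hw0, hw1⟩ := arg_mem_of_mem_upperHalf hw
  have hz2 := Complex.arg_le_pi z
  have hw2 := Complex.arg_le_pi w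
  have hpos : 0 < ‖z‖ * ‖w‖ := mul_pos (norm_pos_iff.2 hz0) (norm_pos_iff.2 hw0)
  rw [cross_eq_sin, mul_pos_iff_of_pos_left hpos]
  constructor
  · intro h
    by_contra hle
    have := Real.sin_nonpos_of_nonpos_of_neg_pi_le (x := w.arg - z.arg) (by linarith) (by linarith)
    linarith
  · intro h
    exact Real.sin_pos_of_pos_of_lt_pi (by linarith) (by linarith)

end Complex

/-! ### Stable objects and Schur's lemma -/

section Stability

variable {C : Type u} [Category.{v} C] [Abelian C] (σ : StabilityFunction C)

namespace StabilityFunction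

theorem phase_lt_iff {X Y : C} (hX : ¬ IsZero X) (hY : ¬ IsZero Y) :
    σ.phase X < σ.phase Y ↔ 0 < cross (σ.Z (cls X)) (σ.Z (cls Y)) := by
  rw [cross_pos_iff (σ.mem_upperHalf X hX) (σ.mem_upperHalf Y hY), phase, phase,
    div_lt_div_iff_of_pos_right Real.pi_pos]

theorem phase_le_iff {X Y : C} (hX : ¬ IsZero X) (hY : ¬ IsZero Y) :
    σ.phase X ≤ σ.phase Y ↔ 0 ≤ cross (σ.Z (cls X)) (σ.Z (cls Y)) := by
  rw [← not_lt, σ.phase_lt_iff hY hX, not_lt]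
  have : cross (σ.Z (cls Y)) (σ.Z (cls X)) = - cross (σ.Z (cls X)) (σ.Z (cls Y)) := by
    simp [cross]; ring
  rw [this, neg_nonpos]

variable {σ}

theorem IsStable.isIso_or_of_mono {X : C} (h : σ.IsStable X) {B : C} (f : B ⟶ X) [Mono f]
    (hB : ¬ IsZero B) : IsIso f ∨ 0 < cross (σ.Z (cls B)) (σ.Z (cls X)) := by
  by_cases hf : IsIso f
  · exact .inl hf
  · right
    have hbot : Subobject.mk f ≠ ⊥ := fun h0 => hB (isZero_of_mono_eq_zero f
      (Subobject.mk_eq_bot_iff_zero.1 h0))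
    have htop : Subobject.mk f ≠ ⊤ := fun h1 => hf ((Subobject.isIso_iff_mk_eq_top f).2 h1)
    have hB' : ¬ IsZero ((Subobject.mk f : Subobject X) : C) := fun hz =>
      hB (hz.of_iso (Subobject.underlyingIso f).symm)
    rw [← cls_iso (Subobject.underlyingIso f), ← σ.phase_lt_iff hB' h.1]
    exact h.2 _ hbot htop

theorem isSemistable_of_mono {X : C} (hX : ¬ IsZero X)
    (h : ∀ (B : C) (f : B ⟶ X), Mono f → 0 ≤ cross (σ.Z (cls B)) (σ.Z (cls X))) :
    σ.IsSemistable X := by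
  refine ⟨hX, fun B hB _ => ?_⟩
  rw [σ.phase_le_iff (fun hz => hB ?_) hX]
  · exact h B B.arrow inferInstance
  · rw [← Subobject.mk_arrow B, Subobject.mk_eq_bot_iff_zero]
    exact hz.eq_of_src _ _

/-- Kernel and image of `f` are both subobjects of `X`, and their cross products with $Z(X)$ add up
to that of $Z(X)$ with itself, which is zero. By stability a nonzero proper subobject contributes a
positive term, so the kernel is zero and the image is all of `X`. -/
theorem IsStable.isIso_of_ne_zero {X : C} (h : σ.IsStable X) (f : X ⟶ X) (hf : f ≠ 0) :
    IsIso f := by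
  let p := factorThruImage f
  have hJ : ¬ IsZero (image f) := fun hz => hf (by
    rw [← image.fac f, hz.eq_of_tgt (factorThruImage f) 0, zero_comp])
  have e := cls_eq_add (shortExact_kernel p)
  dsimp only at e
  have hc := cross_self (σ.Z (cls X))
  nth_rw 1 [e] at hc
  rw [map_add, cross_add_left] at hc
  have hJ0 : IsIso (image.ι f) ∨ 0 < cross (σ.Z (cls (image f))) (σ.Z (cls X)) :=
    h.isIso_or_of_mono (image.ι f) hJ
  have hJ1 : 0 ≤ cross (σ.Z (cls (image f))) (σ.Z (cls X)) := by
    rcases hJ0 with hi | hi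
    · rw [cls_iso (asIso (image.ι f)), cross_self]
    · exact hi.le
  have hK : IsZero (kernel p) := by
    by_contra hK
    rcases h.isIso_or_of_mono (kernel.ι p) hK with hi | hi
    · refine hJ (isZero_of_forall_eq_zero p ?_)
      rw [← cancel_epi (kernel.ι p), kernel.condition, comp_zero]
    · linarith
  have hp : Mono p := Preadditive.mono_of_isZero_kernel p hK
  have hp' : IsIso p := isIso_of_mono_of_epi p
  rw [cls_eq_zero hK, map_zero] at hc
  have hi : IsIso (image.ι f) := hJ0.resolve_right fun hi => by
    simp [cross] at hc hi
    linarith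
  rw [← image.fac f]
  exact IsIso.comp_isIso

/-- By Schur's lemma the endomorphisms form a finite-dimensional division algebra over an
algebraically closed field. -/
theorem IsStable.nonempty_algEquiv {k : Type w} [Field k] [IsAlgClosed k] [Linear k C] {X : C}
    [Module.Finite k (X ⟶ X)] (h : σ.IsStable X) : Nonempty (End X ≃ₐ[k] k) := by
  have hX : 𝟙 X ≠ 0 := fun h0 => h.1 ((IsZero.iff_id_eq_zero X).2 h0)
  have h1 : Module.finrank k (End X) = 1 := finrank_endomorphism_eq_one k fun f =>
    ⟨fun hf h0 => by subst h0; exact h.1 (isZero_of_forall_eq_zero (0 : X ⟶ X) rfl),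
      h.isIso_of_ne_zero f⟩
  have : Nontrivial (End X) := nontrivial_of_ne _ _ hX
  refine ⟨(AlgEquiv.ofBijective (Algebra.ofId k (End X))
    ⟨(algebraMap k (End X)).injective, ?_⟩).symm⟩
  exact Algebra.surjective_algebraMap_iff.2 (Subalgebra.bot_eq_top_of_finrank_eq_one h1).symm

end StabilityFunction

end Stability

end HighestWeight

namespace HighestWeight

/-! ### Vanishing of extensions; maximal quotients and subobjects -/

section Extension

variable {C : Type u} [Category.{v} C] [Abelian C]

/-- Every morphism to `N` from the kernel of an epimorphism onto `Z` extends to its source;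
that is, `Ext¹(Z, N) = 0`. -/
def ExtVanishes (Z N : C) : Prop :=
  ∀ ⦃X Y : C⦄ (f : X ⟶ Y) (p : Y ⟶ Z) (w : f ≫ p = 0), (ShortComplex.mk f p w).ShortExact →
    ∀ g : X ⟶ N, ∃ g' : Y ⟶ N, f ≫ g' = g

theorem shortExact_pushout {X Y Z N : C} {f : X ⟶ Y} {p : Y ⟶ Z} {w : f ≫ p = 0}
    (h : (ShortComplex.mk f p w).ShortExact) (g : X ⟶ N) :
    (ShortComplex.mk (pushout.inr f g) (pushout.desc p 0 (by simp [w]))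
      (pushout.inr_desc _ _ _)).ShortExact := by
  have : Mono f := h.mono_f
  have : Epi p := h.epi_g
  have hepi : Epi (pushout.desc p (0 : N ⟶ Z) (by simp [w]) : pushout f g ⟶ Z) :=
    have : Epi (pushout.inl f g ≫ pushout.desc p (0 : N ⟶ Z) (by simp [w])) := by
      rw [pushout.inl_desc]; exact this
    epi_of_epi (pushout.inl f g) _
  refine { exact := ShortComplex.exact_of_g_is_cokernel _ (CokernelCofork.IsColimit.ofπ' _ _
             fun {A} a ha => ⟨h.exact.desc (pushout.inl f g ≫ a) ?_, ?_⟩)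
           mono_f := inferInstanceAs (Mono (pushout.inr f g))
           epi_g := hepi }
  · dsimp
    rw [pushout.condition_assoc, ha, comp_zero]
  · apply pushout.hom_ext
    · rw [pushout.inl_desc_assoc]
      exact h.exact.g_desc _ _
    · rw [pushout.inr_desc_assoc, zero_comp, ha]

/-- Pushing out along `g` reduces the extension problem to splitting a sequence that starts with `N`
itself. -/
theorem ExtVanishes.of_retraction {Z N : C}
    (h : ∀ ⦃E : C⦄ (i : N ⟶ E) (p : E ⟶ Z) (w : i ≫ p = 0), (ShortComplex.mk i p w).ShortExact →
      ∃ r : E ⟶ N, i ≫ r = 𝟙 N) : ExtVanishes Z N := by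
  intro X Y f p w hT g
  obtain ⟨r, hr⟩ := h _ _ _ (shortExact_pushout hT g)
  exact ⟨pushout.inl f g ≫ r, by rw [pushout.condition_assoc, hr, Category.comp_id]⟩

theorem ExtVanishes.of_isZero {Z : C} (hZ : IsZero Z) (N : C) : ExtVanishes Z N := by
  intro X Y f p w hT g
  have : Mono f := hT.mono_f
  have : Epi f := hT.exact.epi_f (hZ.eq_of_tgt _ _)
  have := isIso_of_mono_of_epi f
  exact ⟨inv f ≫ g, by simp⟩

theorem ExtVanishes.iso {Z Z' N : C} (h : ExtVanishes Z N) (e : Z ≅ Z') : ExtVanishes Z' N := by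
  intro X Y f p w hT g
  refine h f (p ≫ e.inv) (by rw [reassoc_of% w, zero_comp]) ?_ g
  exact ShortComplex.shortExact_of_iso
    (ShortComplex.isoMk (S₁ := ShortComplex.mk f p w)
      (S₂ := ShortComplex.mk f (p ≫ e.inv) (by rw [reassoc_of% w, zero_comp]))
      (Iso.refl _) (Iso.refl _) e.symm (by simp) (by simp)) hT

/-- The map is extended in two stages, through the preimage of `T.X₁` in `Y`: the successive
quotients of $X\subseteq p^{-1}(T.X_1)\subseteq Y$ are `T.X₁` and `T.X₃`. -/
theorem ExtVanishes.extension {N : C} {T : ShortComplex C} (hT : T.ShortExact)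
    (h₁ : ExtVanishes T.X₁ N) (h₃ : ExtVanishes T.X₃ N) : ExtVanishes T.X₂ N := by
  intro X Y f p w h g
  have : Mono T.f := hT.mono_f
  have : Epi T.g := hT.epi_g
  have : Mono f := h.mono_f
  have : Epi p := h.epi_g
  let f₁ : X ⟶ pullback p T.f := pullback.lift f 0 (by simp [w])
  have hf₁ : f₁ ≫ pullback.fst p T.f = f := pullback.lift_fst _ _ _
  have : Mono f₁ := by
    have : Mono (f₁ ≫ pullback.fst p T.f) := by rw [hf₁]; infer_instance
    exact mono_of_mono _ (pullback.fst p T.f)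
  have w₁ : f₁ ≫ pullback.snd p T.f = 0 := pullback.lift_snd _ _ _
  have h₁' : (ShortComplex.mk f₁ (pullback.snd p T.f) w₁).ShortExact :=
    { exact := ShortComplex.exact_of_f_is_kernel _ (KernelFork.IsLimit.ofι' _ _ fun {A} a ha =>
        ⟨h.exact.lift (a ≫ pullback.fst p T.f) (by
          dsimp; rw [Category.assoc, pullback.condition, reassoc_of% ha, zero_comp]), by
          apply pullback.hom_ext
          · rw [Category.assoc, hf₁]
            exact h.exact.lift_f _ _
          · dsimp at ha
            rw [Category.assoc, w₁, comp_zero, ha]⟩)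
      mono_f := ‹_›
      epi_g := inferInstanceAs (Epi (pullback.snd p T.f)) }
  have w₃ : pullback.fst p T.f ≫ p ≫ T.g = 0 := by
    rw [pullback.condition_assoc, T.zero, comp_zero]
  have h₃' : (ShortComplex.mk (pullback.fst p T.f) (p ≫ T.g) w₃).ShortExact :=
    { exact := ShortComplex.exact_of_f_is_kernel _ (KernelFork.IsLimit.ofι' _ _ fun {A} a ha =>
        ⟨pullback.lift a (hT.exact.lift (a ≫ p) (by simpa using ha))
          (hT.exact.lift_f _ _).symm, pullback.lift_fst _ _ _⟩)
      mono_f := inferInstanceAs (Mono (pullback.fst p T.f))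
      epi_g := inferInstanceAs (Epi (p ≫ T.g)) }
  obtain ⟨g₁, hg₁⟩ := h₁ _ _ _ h₁' g
  obtain ⟨g₂, hg₂⟩ := h₃ _ _ _ h₃' g₁
  exact ⟨g₂, by rw [← hf₁, Category.assoc, hg₂, hg₁]⟩

theorem ExtVanishes.of_extensionClosure {N : C} {Q : ObjectProperty C}
    (h : ∀ Z, Q Z → ExtVanishes Z N) {Z : C} (hZ : ExtensionClosure Q Z) : ExtVanishes Z N := by
  induction hZ with
  | of Z hZ => exact h Z hZ
  | zero Z hZ => exact .of_isZero hZ N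
  | extension T hT _ _ h₁ h₃ => exact .extension hT h₁ h₃

/-- Closure of `Q` under subobjects puts the image of `f` in `Q`, so the universal property extends
from epimorphisms to all morphisms. -/
theorem IsMaximalQuotient.exists_factor {Q : ObjectProperty C}
    (hQ : ∀ ⦃X Y : C⦄ (f : X ⟶ Y), Mono f → Q Y → Q X) {P D : C} {q : P ⟶ D}
    (h : IsMaximalQuotient Q q) {Y : C} (hY : Q Y) (f : P ⟶ Y) : ∃ g : D ⟶ Y, q ≫ g = f := by
  obtain ⟨g, hg⟩ := h.maximal (factorThruImage f) inferInstance (hQ (image.ι f) inferInstance hY)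
  exact ⟨g ≫ image.ι f, by rw [reassoc_of% hg, image.fac]⟩

theorem IsMaximalSubobject.exists_factor {Q : ObjectProperty C}
    (hQ : ∀ ⦃X Y : C⦄ (f : X ⟶ Y), Epi f → Q X → Q Y) {I D : C} {e : D ⟶ I}
    (h : IsMaximalSubobject Q e) {Y : C} (hY : Q Y) (f : Y ⟶ I) : ∃ g : Y ⟶ D, g ≫ e = f := by
  obtain ⟨g, hg⟩ := h.maximal (image.ι f) inferInstance (hQ (factorThruImage f) inferInstance hY)
  exact ⟨factorThruImage f ≫ g, by rw [Category.assoc, hg, image.fac]⟩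

variable {k : Type w} [Field k] [Linear k C]

theorem IsMaximalQuotient.finrank_eq {Q : ObjectProperty C}
    (hQ : ∀ ⦃X Y : C⦄ (f : X ⟶ Y), Mono f → Q Y → Q X) {P D : C} {q : P ⟶ D}
    (h : IsMaximalQuotient Q q) {Y : C} (hY : Q Y) :
    Module.finrank k (D ⟶ Y) = Module.finrank k (P ⟶ Y) := by
  have := h.epi
  exact LinearEquiv.finrank_eq (LinearEquiv.ofBijective (Linear.leftComp k Y q)
    ⟨fun a b hab => (cancel_epi q).1 hab, h.exists_factor hQ hY⟩)

theorem IsMaximalSubobject.finrank_eq {Q : ObjectProperty C}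
    (hQ : ∀ ⦃X Y : C⦄ (f : X ⟶ Y), Epi f → Q X → Q Y) {I D : C} {e : D ⟶ I}
    (h : IsMaximalSubobject Q e) {Y : C} (hY : Q Y) :
    Module.finrank k (Y ⟶ D) = Module.finrank k (Y ⟶ I) := by
  have := h.mono
  exact LinearEquiv.finrank_eq (LinearEquiv.ofBijective (Linear.rightComp k Y e)
    ⟨fun a b hab => (cancel_mono e).1 hab, h.exists_factor hQ hY⟩)

end Extension

/-! ### Orthogonality of standard and costandard objects; reciprocity -/

section Reciprocity

variable {C : Type u} [Category.{v} C] [Abelian C] [∀ X : C, IsArtinianObject X]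
  {n : ℕ} {S : Fin n → C} (hS : IsSimpleList S)

section

variable {d : Fin n → C → ℕ} (hd : IsMultiplicity S d)
include hS hd

theorem IsMultiplicity.serreUpTo_of_mono (i : Fin n) ⦃X Y : C⦄ (f : X ⟶ Y) (_ : Mono f)
    (hY : SerreUpTo S i Y) : SerreUpTo S i X := by
  rw [hd.serreUpTo_iff hS] at hY ⊢
  exact fun l hl => Nat.eq_zero_of_le_zero (((hd.additive l).le_of_mono f).trans (hY l hl).le)

theorem IsMultiplicity.serreUpTo_of_epi (i : Fin n) ⦃X Y : C⦄ (f : X ⟶ Y) (_ : Epi f)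
    (hX : SerreUpTo S i X) : SerreUpTo S i Y := by
  rw [hd.serreUpTo_iff hS] at hX ⊢
  exact fun l hl => Nat.eq_zero_of_le_zero (((hd.additive l).le_of_epi f).trans (hX l hl).le)

end

omit [∀ X : C, IsArtinianObject X] in
theorem SerreUpTo.mono {i j : Fin n} (hij : i ≤ j) {X : C} (hX : SerreUpTo S i X) :
    SerreUpTo S j X := by
  unfold SerreUpTo at hX ⊢
  induction hX with
  | of X hX =>
    obtain ⟨l, hl, e⟩ := hX
    exact .of X ⟨l, hl.trans hij, e⟩
  | zero X hX => exact .zero X hX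
  | extension T hT _ _ h₁ h₃ => exact .extension T hT h₁ h₃

variable {k : Type w} [Field k] [Linear k C] {P : Fin n → C} {I : Fin n → C}
  {Δ Nabla : Fin n → C} {q : ∀ i, P i ⟶ Δ i} {e : ∀ i, Nabla i ⟶ I i}
  (hd : IsMultiplicity S fun i X => Module.finrank k (P i ⟶ X))
  (hI : ∀ i X, Module.finrank k (X ⟶ I i) = Module.finrank k (P i ⟶ X))
  (hq : ∀ i, IsMaximalQuotient (SerreUpTo S i) (q i))
  (he : ∀ i, IsMaximalSubobject (SerreUpTo S i) (e i))

include hS hd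

include hq he in
theorem extVanishes_standard_costandard [∀ i, Projective (P i)] [∀ i, Injective (I i)]
    (a b : Fin n) : ExtVanishes (Δ a) (Nabla b) := by
  refine .of_retraction fun E i p w h => ?_
  -- The middle term `E` lies in $\mathcal A_{\max(a,b)}$. If $b\le a$, a lift of `q a` to `E`
  -- descends to a section of `p`; if $a\le b$, an extension of `e b` to `E` factors as a retraction
  -- of `i`.
  rcases le_total b a with hab | hab
  · have := h.epi_g
    have := (hq a).epi
    have hE : SerreUpTo S a E := .extension _ h (SerreUpTo.mono hab (he b).mem) (hq a).mem
    obtain ⟨s, hs⟩ := (hq a).exists_factor (hd.serreUpTo_of_mono hS a) hE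
      (Projective.factorThru (q a) p)
    have hs' : s ≫ p = 𝟙 _ := by
      rw [← cancel_epi (q a), reassoc_of% hs, Projective.factorThru_comp, Category.comp_id]
    have hr := (ShortComplex.Splitting.ofExactOfSection _ h.exact s hs' h.mono_f).f_r
    exact ⟨_, hr⟩
  · have : Mono i := h.mono_f
    have := (he b).mono
    have hE : SerreUpTo S b E := .extension _ h (he b).mem (SerreUpTo.mono hab (hq a).mem)
    obtain ⟨r, hr⟩ := (he b).exists_factor (hd.serreUpTo_of_epi hS b) hE
      (Injective.factorThru (e b) i)
    exact ⟨r, by rw [← cancel_mono (e b), Category.assoc, hr, Injective.comp_factorThru,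
      Category.id_comp]⟩

include hI hq he in
-- For $a\le b$ the space is $\mathrm{Hom}(\Delta_a,I_b)$, of dimension $[\Delta_a:S_b]$; for $b<a$
-- it is $\mathrm{Hom}(P_a,\nabla_b)$, of dimension $[\nabla_b:S_a]=0$.
theorem finrank_standard_costandard
    (hΔ : ∀ i, Module.finrank k (P i ⟶ Δ i) = 1) (a b : Fin n) :
    Module.finrank k (Δ a ⟶ Nabla b) = if a = b then 1 else 0 := by
  rcases le_or_gt a b with hab | hab
  · rw [(he b).finrank_eq (hd.serreUpTo_of_epi hS b) (SerreUpTo.mono hab (hq a).mem), hI]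
    split_ifs with h
    · subst h
      exact hΔ a
    · exact (hd.serreUpTo_iff hS a _).1 (hq a).mem b (lt_of_le_of_ne hab h)
  · rw [(hq a).finrank_eq (hd.serreUpTo_of_mono hS a) (SerreUpTo.mono hab.le (he b).mem),
      if_neg hab.ne']
    exact (hd.serreUpTo_iff hS b _).1 (he b).mem a hab

include hI hq he in
/-- Brauer–Humphreys reciprocity for objects filtered by standard objects. -/
theorem cls_eq_sum_of_extensionClosure [∀ X Y : C, Module.Finite k (X ⟶ Y)]
    [∀ i, Projective (P i)] [∀ i, Injective (I i)]
    (hΔ : ∀ i, Module.finrank k (P i ⟶ Δ i) = 1) (i : Fin n) {X : C}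
    (hX : ExtensionClosure (fun X => ∃ j, i ≤ j ∧ Nonempty (X ≅ Δ j)) X) :
    cls X = ∑ j ∈ Finset.Ici i, Module.finrank k (X ⟶ Nabla j) • cls (Δ j) := by
  induction hX with
  | of X hX =>
    obtain ⟨a, ha, ⟨f⟩⟩ := hX
    rw [cls_iso f, Finset.sum_eq_single a]
    · rw [(Linear.homCongr k f (Iso.refl (Nabla a))).finrank_eq,
        finrank_standard_costandard hS hd hI hq he hΔ, if_pos rfl, one_smul]
    · intro b _ hb
      rw [(Linear.homCongr k f (Iso.refl (Nabla b))).finrank_eq,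
        finrank_standard_costandard hS hd hI hq he hΔ, if_neg hb.symm, zero_smul]
    · intro h
      exact absurd (Finset.mem_Ici.2 ha) h
  | zero X hX =>
    rw [cls_eq_zero hX, Finset.sum_eq_zero]
    intro j _
    have : Subsingleton (X ⟶ Nabla j) := ⟨fun _ _ => hX.eq_of_src _ _⟩
    rw [Module.finrank_zero_of_subsingleton, zero_smul]
  | extension T hT _ hX₃ h₁ h₃ =>
    rw [cls_eq_add hT, h₁, h₃, ← Finset.sum_add_distrib]
    refine Finset.sum_congr rfl fun j _ => ?_
    have hext : ExtVanishes T.X₃ (Nabla j) := .of_extensionClosure (by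
      rintro Z ⟨a, -, ⟨f⟩⟩
      exact (extVanishes_standard_costandard hS hd hq he a j).iso f.symm) hX₃
    rw [finrank_hom_to_eq_add (Nabla j) hT (hext _ _ _ hT), add_smul]

end Reciprocity

end HighestWeight

namespace HighestWeight

/-! ### The trace filtration of a projective cover -/

section Trace

variable {C : Type u} [Category.{v} C] [Abelian C] [∀ X : C, IsArtinianObject X]
  {n : ℕ} {S : Fin n → C} (hS : IsSimpleList S)

omit [∀ X : C, IsArtinianObject X] in
theorem subobject_eq_top_of_isZero_cokernel {A : C} (t : Subobject A)
    (h : IsZero (cokernel t.arrow)) : t = ⊤ := by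
  have := Preadditive.epi_of_isZero_cokernel t.arrow h
  have := isIso_of_mono_of_epi t.arrow
  exact (Subobject.isIso_arrow_iff_eq_top t).1 this

omit [∀ X : C, IsArtinianObject X] in
theorem subobject_eq_bot_of_isZero {A : C} (t : Subobject A) (h : IsZero (t : C)) : t = ⊥ := by
  rw [← Subobject.mk_arrow t, Subobject.mk_eq_bot_iff_zero]
  exact h.eq_of_src _ _

/-- The trace in `A` of the projective covers indexed by `J`. -/
theorem IsMultiplicity.exists_trace {d : Fin n → C → ℕ} (hd : IsMultiplicity S d) (A : C)
    (J : Set (Fin n)) : ∃ t : Subobject A, (∀ l ∈ J, d l (cokernel t.arrow) = 0) ∧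
      ∀ X : C, (∀ l ∈ J, d l X = 0) → ∀ f : (t : C) ⟶ X, f = 0 := by
  -- The trace is obtained as a minimal subobject whose quotient has no composition factor indexed
  -- by `J`. The kernel of any `f` into an `X` without such factors is again a candidate, so by
  -- minimality it is all of `t`.
  obtain ⟨t, ht, hmin⟩ := WellFounded.has_min (wellFounded_lt (α := Subobject A))
    {t | ∀ l ∈ J, d l (cokernel t.arrow) = 0} ⟨⊤, fun l _ =>
      (hd.additive l).eq_zero (isZero_cokernel_of_epi (⊤ : Subobject A).arrow)⟩
  refine ⟨t, ht, fun X hX f => ?_⟩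
  let s : Subobject A := Subobject.mk (kernel.ι f ≫ t.arrow)
  have hst : s ≤ t := Subobject.mk_le_of_comm (kernel.ι f) rfl
  have hs : s ∈ {t : Subobject A | ∀ l ∈ J, d l (cokernel t.arrow) = 0} := fun l hl => by
    have h1 := (hd.additive l).mono s.arrow
    have h2 := (hd.additive l).mono t.arrow
    have h3 := (hd.additive l).iso (Subobject.underlyingIso (kernel.ι f ≫ t.arrow))
    have h4 := (hd.additive l).epi (factorThruImage f)
    have h5 := (hd.additive l).le_of_mono (image.ι f)
    have h6 := (hd.additive l).iso (kernelIsoOfEq (image.fac f))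
    have h7 := (hd.additive l).iso (kernelCompMono (factorThruImage f) (image.ι f))
    rw [hX l hl] at h5
    rw [ht l hl] at h2
    change d l (s : C) = _ at h3
    omega
  have hts : s = t := hst.eq_of_not_lt (hmin s hs)
  have hle : t ≤ s := hts.ge
  have e : t.ofLEMk (kernel.ι f ≫ t.arrow) hle ≫ kernel.ι f = 𝟙 _ := by
    rw [← cancel_mono t.arrow, Category.assoc, Subobject.ofLEMk_comp, Category.id_comp]
  rw [← Category.id_comp f, ← e, Category.assoc, kernel.condition, comp_zero]

variable {k : Type w} [Field k] [Linear k C] [∀ X Y : C, Module.Finite k (X ⟶ Y)]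
  {P : Fin n → C} {I : Fin n → C} {Δ Nabla : Fin n → C} {q : ∀ i, P i ⟶ Δ i}
  {e : ∀ i, Nabla i ⟶ I i}
  (hd : IsMultiplicity S fun i X => Module.finrank k (P i ⟶ X))
  (hI : ∀ i X, Module.finrank k (X ⟶ I i) = Module.finrank k (P i ⟶ X))
  (hq : ∀ i, IsMaximalQuotient (SerreUpTo S i) (q i))
  (he : ∀ i, IsMaximalSubobject (SerreUpTo S i) (e i))

attribute [local instance] Abelian.hasFiniteBiproducts

include hS hd hq in
-- A basis of $\mathrm{Hom}(P_j,Q)$ factors through $\Delta_j$. The cokernel of the resulting map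
-- has no factor $S_j$, since maps from $P_j$ lift to `Q`, and none above $j$, so `hgen` kills it.
-- The number of copies is exactly $[Q:S_j]$, which the later length count needs.
theorem exists_epi_from_standard [∀ i, Projective (P i)] (j : Fin n) {Q : C}
    (hQ : SerreUpTo S j Q)
    (hgen : ∀ (R : C) (f : Q ⟶ R), (∀ l, j ≤ l → Module.finrank k (P l ⟶ R) = 0) → f = 0) :
    ∃ G : (⨁ fun _ : Fin (Module.finrank k (P j ⟶ Q)) => Δ j) ⟶ Q, Epi G := by
  let b := Module.finBasis k (P j ⟶ Q)
  choose g hg using fun a => (hq j).exists_factor (hd.serreUpTo_of_mono hS j) hQ (b a)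
  let G : (⨁ fun _ : Fin (Module.finrank k (P j ⟶ Q)) => Δ j) ⟶ Q := biproduct.desc g
  refine ⟨G, Preadditive.epi_of_cokernel_zero (hgen _ _ fun l hl => ?_)⟩
  rcases hl.eq_or_lt with rfl | hl
  · have h0 : Linear.rightComp k (P j) (cokernel.π G) = 0 := b.ext fun a => by
      have : g a = biproduct.ι (fun _ : Fin (Module.finrank k (P j ⟶ Q)) => Δ j) a ≫ G :=
        (biproduct.ι_desc g a).symm
      rw [← hg a, this]
      simp
    have : Subsingleton (P j ⟶ cokernel G) := subsingleton_of_forall_eq 0 fun f => by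
      rw [← Projective.factorThru_comp f (cokernel.π G)]
      exact LinearMap.congr_fun h0 (Projective.factorThru f (cokernel.π G))
    exact Module.finrank_zero_of_subsingleton
  · have h1 := (hd.additive l).le_of_epi (cokernel.π G)
    have h2 := (hd.serreUpTo_iff hS j Q).1 hQ l hl
    omega

omit [∀ X Y : C, Module.Finite k (X ⟶ Y)] in
include hS hd hI he in
/-- Morphisms to a costandard object only see the quotient by the trace. -/
theorem finrank_hom_costandard {A : C} (j : Fin n) (t : Subobject A)
    (ht : ∀ l, j < l → Module.finrank k (P l ⟶ cokernel t.arrow) = 0)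
    (htX : ∀ X : C, (∀ l, j < l → Module.finrank k (P l ⟶ X) = 0) → ∀ f : (t : C) ⟶ X, f = 0) :
    Module.finrank k (A ⟶ Nabla j) = Module.finrank k (P j ⟶ cokernel t.arrow) := by
  rw [← hI, ← (he j).finrank_eq (hd.serreUpTo_of_epi hS j) ((hd.serreUpTo_iff hS j _).2 ht)]
  refine (LinearEquiv.finrank_eq (LinearEquiv.ofBijective
    (Linear.leftComp k (Nabla j) (cokernel.π t.arrow)) ⟨fun a b hab => ?_, fun f => ?_⟩)).symm
  · exact (cancel_epi (cokernel.π t.arrow)).1 hab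
  · have h0 : t.arrow ≫ f = 0 := htX _ ((hd.serreUpTo_iff hS j _).1 (he j).mem) _
    exact ⟨cokernel.desc t.arrow f h0, cokernel.π_desc _ _ _⟩

include hS hd hI hq he in
-- Each trace layer is a quotient of $\Delta_j^{m_j}$ with $m_j=[\nabla_j:S_i]$, and `hcls` says the
-- lengths of these sums already add up to the length of $P_i$, leaving no room for kernels.
theorem exists_standard_filtration [∀ i, Projective (P i)] (i : Fin n)
    (hcls : cls (P i) = ∑ j ∈ Finset.Ici i,
      Module.finrank k (P i ⟶ Nabla j) • cls (Δ j)) :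
    ∃ (t : ℕ → Subobject (P i)) (ht : ∀ j, t (j + 1) ≤ t j), t 0 = ⊤ ∧ t n = ⊥ ∧
      ∀ j : Fin n, (j < i → t (j + 1) = t j) ∧ ∃ m : ℕ,
        Nonempty (cokernel ((t (j + 1)).ofLE (t j) (ht j)) ≅ ⨁ fun _ : Fin m => Δ j) := by
  set L := totalMult fun i X => Module.finrank k (P i ⟶ X)
  have hLadd : IsAdditive L := hd.isAdditive_totalMult
  -- Natural-number thresholds include $j=n$, where the index set is empty and the trace is zero.
  choose t ht htX using fun j : ℕ => hd.exists_trace (P i) {l : Fin n | j ≤ l}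
  simp only [Set.mem_ofPred_eq] at ht htX
  have hle : ∀ j, t (j + 1) ≤ t j := fun j => by
    have h0 := htX (j + 1) (cokernel (t j).arrow) (fun l hl => ht j l (by omega))
      ((t (j + 1)).arrow ≫ cokernel.π _)
    exact Subobject.le_of_comm ((shortExact_cokernel (t j).arrow).exact.lift _ h0)
      ((shortExact_cokernel (t j).arrow).exact.lift_f _ h0)
  have htop : ∀ j : ℕ, j ≤ i → t j = ⊤ := fun j hj => by
    have h0 : cokernel.π (t j).arrow = 0 := by
      have : Subsingleton (P i ⟶ cokernel (t j).arrow) :=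
        Module.finrank_zero_iff.1 (ht j i hj)
      exact Subsingleton.elim _ _
    exact subobject_eq_top_of_isZero_cokernel _ (isZero_of_forall_eq_zero _ h0)
  have hbot : t n = ⊥ := subobject_eq_bot_of_isZero _ ((IsZero.iff_id_eq_zero _).2
    (htX n _ (fun l hl => absurd l.2 (by omega)) _))
  let Q : ℕ → C := fun j => cokernel ((t (j + 1)).ofLE (t j) (hle j))
  have hQadd : ∀ (d : C → ℕ), IsAdditive d → ∀ j, d (t j : C) = d (t (j + 1) : C) + d (Q j) :=
    fun d hd' j => hd'.mono _
  have hQle : ∀ (l : Fin n) (j : ℕ), Module.finrank k (P l ⟶ Q j) ≤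
      Module.finrank k (P l ⟶ cokernel (t (j + 1)).arrow) := fun l j => by
    have h1 := hQadd _ (hd.additive l) j
    have h2 := (hd.additive l).mono (t (j + 1)).arrow
    have h3 := (hd.additive l).le_of_mono (t j).arrow
    omega
  have hQS : ∀ j : Fin n, SerreUpTo S j (Q j) := fun j =>
    (hd.serreUpTo_iff hS j _).2 fun l hl =>
      Nat.eq_zero_of_le_zero ((hQle l j).trans (ht (j + 1) l hl).le)
  have hQgen : ∀ (j : Fin n) (R : C) (f : Q j ⟶ R),
      (∀ l, j ≤ l → Module.finrank k (P l ⟶ R) = 0) → f = 0 := fun j R f hR => by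
    rw [← cancel_epi (cokernel.π ((t (j + 1)).ofLE (t j) (hle j))), comp_zero]
    exact htX j R hR _
  -- Both sides count $S_j$ in $P_i/t_{j+1}$: the left by maps to $\nabla_j$, the right because
  -- $P_i/t_j$ contains no $S_j$.
  have hmult : ∀ j : Fin n, Module.finrank k (P i ⟶ Nabla j) = Module.finrank k (P j ⟶ Q j) :=
    fun j => by
      rw [finrank_hom_costandard hS hd hI he j (t (j + 1)) (ht (j + 1)) (htX (j + 1))]
      have h1 := hQadd _ (hd.additive j) j
      have h2 := (hd.additive j).mono (t (j + 1)).arrow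
      have h3 := (hd.additive j).mono (t j).arrow
      have h4 := ht j j le_rfl
      omega
  choose G hG using fun j => exists_epi_from_standard hS hd hq j (hQS j) (hQgen j)
  have hlt : ∀ j : Fin n, j < i → t (j + 1) = t j := fun j hj => by
    have h1 : (j : ℕ) < i := hj
    rw [htop j h1.le, htop (j + 1) h1]
  have hQ0 : ∀ j : Fin n, j < i → L (Q j) = 0 ∧ Module.finrank k (P j ⟶ Q j) = 0 := fun j hj => by
    have h1 := hQadd _ hLadd j
    have h2 := hQadd _ (hd.additive j) j
    rw [hlt j hj] at h1 h2
    omega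
  have hLG : ∀ j : Fin n, L (Q j) ≤ Module.finrank k (P j ⟶ Q j) * L (Δ j) := fun j => by
    have := hG j
    rw [← hLadd.biproduct]
    exact hLadd.le_of_epi (G j)
  have hsumQ : L (P i) = ∑ j : Fin n, L (Q j) := by
    have h1 : ∀ j, L (t 0 : C) = ∑ l ∈ Finset.range j, L (Q l) + L (t j : C) := fun j => by
      induction j with
      | zero => simp
      | succ j ih => rw [ih, Finset.sum_range_succ, hQadd L hLadd j]; ring
    have h2 := h1 n
    rw [hbot, hLadd.eq_zero (isZero_bot _), add_zero, htop 0 (Nat.zero_le _),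
      hLadd.iso (asIso (⊤ : Subobject (P i)).arrow)] at h2
    rw [h2, Fin.sum_univ_eq_sum_range (fun l => L (Q l))]
  have hsumΔ : L (P i) = ∑ j : Fin n, Module.finrank k (P j ⟶ Q j) * L (Δ j) := by
    have h1 := congrArg hLadd.hom hcls
    simp only [map_sum, map_nsmul, IsAdditive.hom_cls, nsmul_eq_mul, hmult] at h1
    have h2 : L (P i) = ∑ j ∈ Finset.Ici i, Module.finrank k (P j ⟶ Q j) * L (Δ j) := by
      exact_mod_cast h1
    rw [h2]
    refine Finset.sum_subset (Finset.subset_univ _) fun j _ hj => ?_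
    rw [(hQ0 j (by simpa using hj)).2, zero_mul]
  -- Termwise inequalities between sums with the same total are equalities.
  have heq : ∀ j : Fin n, L (Q j) = Module.finrank k (P j ⟶ Q j) * L (Δ j) := fun j =>
    (Finset.sum_eq_sum_iff_of_le fun j _ => hLG j).1 (hsumQ.symm.trans hsumΔ) j (Finset.mem_univ j)
  refine ⟨t, hle, htop 0 (Nat.zero_le _), hbot, fun j =>
    ⟨hlt j, Module.finrank k (P j ⟶ Q j), ?_⟩⟩
  have := hG j
  have : IsIso (G j) := hd.isIso_of_epi hS (G j) (by
    change L _ ≤ L _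
    rw [hLadd.biproduct, heq])
  exact ⟨(asIso (G j)).symm⟩

end Trace

/-! ### Removing repetitions from a chain -/

section Refinement

variable {C : Type u} [Category.{v} C] [Abelian C]

/-- Removes the repetitions from a descending chain of subobjects and reverses it. -/
theorem exists_strict_chain {A : C} {n : ℕ} (t : ℕ → Subobject A) (hn : t n = ⊥)
    (R : ℕ → Subobject A → Subobject A → Prop)
    (h : ∀ j, j < n → t (j + 1) = t j ∨ R j (t (j + 1)) (t j)) {j : ℕ} (hj : j ≤ n) :
    ∃ (m : ℕ) (a : ℕ → Subobject A) (c : ℕ → ℕ), a 0 = ⊥ ∧ a m = t j ∧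
      (∀ l, l < m → j ≤ c l ∧ c l < n ∧ R (c l) (a l) (a (l + 1))) ∧
      ∀ l l', l < l' → l' < m → c l' < c l := by
  -- Descending from $n$ builds the ascending chain from `⊥`; `c` records the original index of each
  -- surviving step, so it decreases along the chain.
  induction hj using Nat.decreasingInduction with
  | self => exact ⟨0, fun _ => ⊥, fun _ => 0, rfl, hn.symm, fun l hl => absurd hl (Nat.not_lt_zero l),
      fun l l' _ hl' => absurd hl' (Nat.not_lt_zero l')⟩
  | of_succ j hj ih =>
    obtain ⟨m, a, c, h0, hm, hR, hc⟩ := ih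
    rcases h j hj with e | e
    · exact ⟨m, a, c, h0, hm.trans e,
        fun l hl => ⟨(Nat.le_succ j).trans (hR l hl).1, (hR l hl).2⟩, hc⟩
    · refine ⟨m + 1, fun l => if l ≤ m then a l else t j, fun l => if l < m then c l else j,
        by simpa using h0, by simp, fun l hl => ?_, fun l l' hll' hl' => ?_⟩
      · rcases (Nat.lt_succ_iff.1 hl).lt_or_eq with hl | rfl
        · have := hR l hl
          simp only [hl, if_true, hl.le, Nat.succ_le_of_lt hl]
          exact ⟨by omega, this.2⟩
        · simp [hm, e, hj]
      · rcases (Nat.lt_succ_iff.1 hl').lt_or_eq with hl' | rfl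
        · simpa [hl', hll'.trans hl'] using hc l l' hll' hl'
        · have := (hR l hll').1
          simp only [hll', if_true, lt_irrefl, if_false]
          omega

end Refinement

end HighestWeight

namespace HighestWeight

/-! ### Semistability of multiples of a stable object; the function $-W+iL$ -/

section Semistable

variable {C : Type u} [Category.{v} C] [Abelian C] {σ : StabilityFunction C}

attribute [local instance] Abelian.hasFiniteBiproducts

theorem cross_zero_left (z : ℂ) : cross 0 z = 0 := by
  simp [cross]

/-- The bound `φ(B) ≤ φ(X)` on all subobjects `B` is inherited by iterated extensions of a stable
object. -/
theorem StabilityFunction.IsStable.cross_nonneg {D : C} (h : σ.IsStable D) {X : C}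
    (hX : ExtensionClosure (fun X => Nonempty (X ≅ D)) X) (B : C) (f : B ⟶ X) [Mono f] :
    0 ≤ cross (σ.Z (cls B)) (σ.Z (cls D)) := by
  induction hX generalizing B with
  | of X hX =>
    obtain ⟨e⟩ := hX
    by_cases hB : IsZero B
    · rw [cls_eq_zero hB, map_zero, cross_zero_left]
    · rcases h.isIso_or_of_mono (f ≫ e.hom) hB with hi | hi
      · rw [cls_iso (asIso (f ≫ e.hom)), cross_self]
      · exact hi.le
  | zero X hX =>
    rw [cls_eq_zero (isZero_of_mono_eq_zero f (hX.eq_of_tgt _ _)), map_zero, cross_zero_left]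
  | extension T hT _ _ h₁ h₃ =>
    have : Mono T.f := hT.mono_f
    -- `B` is cut into its part inside `T.X₁` and its image in `T.X₃`; the two bounds add.
    have w : (kernel.ι (factorThruImage (f ≫ T.g)) ≫ f) ≫ T.g = 0 := by
      rw [Category.assoc]
      simpa only [Category.assoc, image.fac, zero_comp] using
        kernel.condition (factorThruImage (f ≫ T.g)) =≫ image.ι (f ≫ T.g)
    have hl := hT.exact.lift_f _ w
    have : Mono (hT.exact.lift _ w) := by
      have : Mono (hT.exact.lift _ w ≫ T.f) := by rw [hl]; infer_instance
      exact mono_of_mono _ T.f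
    have e := cls_eq_add (shortExact_kernel (factorThruImage (f ≫ T.g)))
    dsimp only at e
    rw [e, map_add, cross_add_left]
    exact add_nonneg (h₁ _ (hT.exact.lift _ w)) (h₃ _ (image.ι (f ≫ T.g)))

theorem cls_biproduct (X : C) (m : ℕ) : cls (⨁ fun _ : Fin m => X) = m • cls X := by
  induction m with
  | zero => rw [cls_eq_zero (isZero_biproduct_of_isEmpty _), zero_smul]
  | succ m ih =>
    have : cls (⨁ fun _ : Fin (m + 1) => X) = cls X + cls (⨁ fun _ : Fin m => X) :=
      cls_eq_add (shortExact_biproductSucc fun _ : Fin (m + 1) => X)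
    rw [this, ih, succ_nsmul']

theorem StabilityFunction.IsStable.isSemistable_biproduct {D : C} (h : σ.IsStable D) {X : C}
    (hX : ¬ IsZero X) {m : ℕ} (i : X ≅ ⨁ fun _ : Fin m => D) :
    σ.IsSemistable X ∧ σ.phase X = σ.phase D := by
  have hZ : σ.Z (cls X) = (m : ℝ) * σ.Z (cls D) := by
    rw [cls_iso i, cls_biproduct, map_nsmul, nsmul_eq_mul, Complex.ofReal_natCast]
  have hm : (0 : ℝ) < m := by
    rcases Nat.eq_zero_or_pos m with rfl | hm
    · exact absurd ((isZero_biproduct_of_isEmpty _).of_iso i) hX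
    · exact_mod_cast hm
  have hcross : ∀ z : ℂ, cross z (σ.Z (cls X)) = m * cross z (σ.Z (cls D)) := fun z => by
    rw [hZ, cross, cross, Complex.re_ofReal_mul, Complex.im_ofReal_mul]
    ring
  refine ⟨StabilityFunction.isSemistable_of_mono hX fun B f _ => ?_, ?_⟩
  · rw [hcross]
    exact mul_nonneg hm.le (h.cross_nonneg (.iso (.biproduct _ fun _ => ⟨Iso.refl _⟩) i.symm) B f)
  · rw [StabilityFunction.phase, hZ, Complex.arg_real_mul _ hm, StabilityFunction.phase]

/-- The stability function `X ↦ -W(X) + i L(X)`. -/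
noncomputable def stabilityOfAdditive {W L : C → ℕ} (hW : IsAdditive W) (hL : IsAdditive L)
    (h : ∀ X, L X = 0 → IsZero X) : StabilityFunction C where
  Z := (AddMonoidHom.mulRight Complex.I).comp ((Int.castAddHom ℂ).comp hL.hom) -
    (Int.castAddHom ℂ).comp hW.hom
  mem_upperHalf X hX := mem_upperHalf_of_im_pos (by
    simpa using Nat.pos_of_ne_zero fun h0 => hX (h X h0))

theorem cross_stabilityOfAdditive {W L : C → ℕ} (hW : IsAdditive W) (hL : IsAdditive L)
    (h : ∀ X, L X = 0 → IsZero X) (X Y : C) :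
    cross ((stabilityOfAdditive hW hL h).Z (cls X)) ((stabilityOfAdditive hW hL h).Z (cls Y)) =
      L X * W Y - W X * L Y := by
  simp [stabilityOfAdditive, cross]
  ring

end Semistable

/-! ### Stability of standard objects and the Harder–Narasimhan filtration -/

section StandardStable

variable {C : Type u} [Category.{v} C] [Abelian C] [∀ X : C, IsArtinianObject X]
  {n : ℕ} {S : Fin n → C} {d : Fin n → C → ℕ} {Δ : Fin n → C}

theorem sum_mul_pow_le (x : Fin n → ℕ) (i : ℕ) (h : ∀ l : Fin n, i < l → x l = 0) {b : ℕ}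
    (hb : 0 < b) : ∑ l, x l * b ^ (l : ℕ) ≤ (∑ l, x l) * b ^ i := by
  rw [Finset.sum_mul]
  refine Finset.sum_le_sum fun l _ => ?_
  rcases lt_or_ge i l with hl | hl
  · simp [h l hl]
  · exact Nat.mul_le_mul_left _ (Nat.pow_le_pow_right hb hl)

/-- For $Z=-W+iL$ the phase grows with $W/L$. Since $W(\Delta_i)\ge b^i$ and $L(\Delta_i)<b$, the
ratio of $\Delta_i$ exceeds $b^{i-1}$ and is at most $b^i$, so phases increase with $i$. A proper
subobject has only factors $S_l$ with $l<i$, so its ratio is at most $b^{i-1}$. -/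
theorem exists_stabilityFunction (hS : IsSimpleList S) (hd : IsMultiplicity S d)
    (hΔ : ∀ i, d i (Δ i) = 1) (hΔ' : ∀ i l, i < l → d l (Δ i) = 0)
    (hsub : ∀ i (B : Subobject (Δ i)), B ≠ ⊤ → d i (B : C) = 0) :
    ∃ σ : StabilityFunction C, (∀ i, σ.IsStable (Δ i)) ∧ StrictMono fun i => σ.phase (Δ i) := by
  set b := 1 + ∑ j, totalMult d (Δ j) with hb
  have hbL : ∀ j, totalMult d (Δ j) < b := fun j => by
    have := Finset.single_le_sum (f := fun j => totalMult d (Δ j)) (fun _ _ => Nat.zero_le _)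
      (Finset.mem_univ j)
    omega
  have hb0 : 0 < b := by omega
  have hW : IsAdditive fun X => ∑ l : Fin n, d l X * b ^ (l : ℕ) :=
    isAdditive_sum Finset.univ (fun (l : Fin n) X => d l X * b ^ (l : ℕ)) fun l T hT => by
      simp only [hd.additive l T hT, add_mul]
  set W := fun X => ∑ l : Fin n, d l X * b ^ (l : ℕ)
  have hL := hd.isAdditive_totalMult
  have hz : ∀ X, totalMult d X = 0 → IsZero X := fun X => hd.isZero_of_totalMult hS
  have hΔ0 : ∀ i, ¬ IsZero (Δ i) := fun i h => by
    have := (hd.additive i).eq_zero h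
    rw [hΔ] at this
    omega
  have hWΔ : ∀ i : Fin n, b ^ (i : ℕ) ≤ W (Δ i) := fun i => by
    have := Finset.single_le_sum (f := fun l : Fin n => d l (Δ i) * b ^ (l : ℕ))
      (fun _ _ => Nat.zero_le _) (Finset.mem_univ i)
    simpa [hΔ] using this
  have hpos : ∀ X, ¬ IsZero X → 0 < totalMult d X := fun X hX =>
    Nat.pos_of_ne_zero fun h => hX (hz X h)
  refine ⟨stabilityOfAdditive hW hL hz, fun i => ⟨hΔ0 i, fun B hB hB' => ?_⟩, fun i j hij => ?_⟩
  · have hB0 : ¬ IsZero (B : C) := fun h => hB (subobject_eq_bot_of_isZero B h)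
    rw [StabilityFunction.phase_lt_iff _ hB0 (hΔ0 i), cross_stabilityOfAdditive, sub_pos]
    have hdB : ∀ l : Fin n, (i : ℕ) ≤ l → d l (B : C) = 0 := fun l hl => by
      rcases (show i ≤ l from hl).eq_or_lt with rfl | hl
      · exact hsub i B hB'
      · exact Nat.eq_zero_of_le_zero (((hd.additive l).le_of_mono B.arrow).trans (hΔ' i l hl).le)
    have h1 : W (B : C) * b ≤ totalMult d (B : C) * b ^ (i : ℕ) := by
      -- For the lowest index no composition factor is left for `B`, so the exponent $i-1$ is only
      -- needed when $i>0$.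
      rcases Nat.eq_zero_or_eq_succ_pred (i : ℕ) with h0 | h0
      · exact absurd (hd.isZero_of_forall hS fun l => hdB l (by omega)) hB0
      · rw [h0, pow_succ, ← mul_assoc]
        exact Nat.mul_le_mul_right b (sum_mul_pow_le (fun l => d l (B : C)) _
          (fun l hl => hdB l (by omega)) hb0)
    have h2 : totalMult d (B : C) ≤ W (B : C) := Finset.sum_le_sum fun l _ =>
      Nat.le_mul_of_pos_right _ (pow_pos hb0 _)
    have h3 : W (B : C) * totalMult d (Δ i) < W (B : C) * b :=
      Nat.mul_lt_mul_of_pos_left (hbL i) ((hpos _ hB0).trans_le h2)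
    exact_mod_cast h3.trans_le (h1.trans (Nat.mul_le_mul_left _ (hWΔ i)))
  · dsimp only
    rw [StabilityFunction.phase_lt_iff _ (hΔ0 i) (hΔ0 j), cross_stabilityOfAdditive, sub_pos]
    have h1 : W (Δ i) ≤ totalMult d (Δ i) * b ^ (i : ℕ) :=
      sum_mul_pow_le (fun l => d l (Δ i)) i (fun l hl => hΔ' i l hl) hb0
    have h2 : W (Δ i) * totalMult d (Δ j) < W (Δ i) * b :=
      Nat.mul_lt_mul_of_pos_left (hbL j) ((pow_pos hb0 _).trans_le (hWΔ i))
    have h3 : W (Δ i) * b ≤ totalMult d (Δ i) * b ^ (j : ℕ) := by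
      refine (Nat.mul_le_mul_right b h1).trans ?_
      rw [mul_assoc, ← pow_succ]
      exact Nat.mul_le_mul_left _ (Nat.pow_le_pow_right hb0 hij)
    exact_mod_cast h2.trans_le (h3.trans (Nat.mul_le_mul_left _ (hWΔ j)))

omit [∀ X : C, IsArtinianObject X] in
-- A nonzero quotient of `D` receives a nonzero map from `P`, which uses up the only dimension of
-- $\mathrm{Hom}(P,D)$ and leaves none for the subobject.
theorem finrank_subobject_standard {k : Type w} [Field k] [Linear k C]
    [∀ X Y : C, Module.Finite k (X ⟶ Y)] {P D : C} [Projective P] (q : P ⟶ D) [Epi q]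
    (hD : Module.finrank k (P ⟶ D) = 1) (B : Subobject D) (hB : B ≠ ⊤) :
    Module.finrank k (P ⟶ (B : C)) = 0 := by
  have h1 := (isAdditive_finrank_hom_from (k := k) P).mono B.arrow
  have h2 : Module.finrank k (P ⟶ cokernel B.arrow) ≠ 0 := fun h0 => by
    have : Subsingleton (P ⟶ cokernel B.arrow) := Module.finrank_zero_iff.1 h0
    exact hB (subobject_eq_top_of_isZero_cokernel B
      (isZero_of_forall_eq_zero (q ≫ cokernel.π B.arrow) (Subsingleton.elim _ _)))
  omega

omit [∀ X : C, IsArtinianObject X] in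
/-- The chain of traces, with repetitions removed, is a Harder–Narasimhan filtration. -/
theorem exists_isHarderNarasimhan {σ : StabilityFunction C} (hσ : ∀ i, σ.IsStable (Δ i))
    (hmono : StrictMono fun i => σ.phase (Δ i)) (i : Fin n) {A : C} (t : ℕ → Subobject A)
    (ht : ∀ j, t (j + 1) ≤ t j) (h0 : t 0 = ⊤) (hn : t n = ⊥)
    (h : haveI := Abelian.hasFiniteBiproducts (C := C)
      ∀ j : Fin n, (j < i → t (j + 1) = t j) ∧ ∃ m : ℕ,
        Nonempty (cokernel ((t (j + 1)).ofLE (t j) (ht j)) ≅ ⨁ fun _ : Fin m => Δ j)) :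
    ∃ F : Filtration A, σ.IsHarderNarasimhan F ∧ ∀ t, IsDirectSumFrom Δ i (F.factor t) := by
  have := Abelian.hasFiniteBiproducts (C := C)
  let R : ℕ → Subobject A → Subobject A → Prop := fun j x y =>
    ∃ (hj : j < n) (hxy : x ≤ y), i ≤ (⟨j, hj⟩ : Fin n) ∧ ¬ IsZero (cokernel (x.ofLE y hxy)) ∧
      ∃ m : ℕ, Nonempty (cokernel (x.ofLE y hxy) ≅ ⨁ fun _ : Fin m => Δ ⟨j, hj⟩)
  obtain ⟨m, a, c, ha0, ham, hR, hc⟩ := exists_strict_chain t hn R (fun j hj => by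
    by_cases e : t (j + 1) = t j
    · exact .inl e
    · refine .inr ⟨hj, ht j, not_lt.1 fun hji => e ((h ⟨j, hj⟩).1 hji), fun hz => e ?_,
        (h ⟨j, hj⟩).2⟩
      have := Preadditive.epi_of_isZero_cokernel _ hz
      have := isIso_of_mono_of_epi ((t (j + 1)).ofLE (t j) (ht j))
      refine (ht j).antisymm (Subobject.le_of_comm (inv ((t (j + 1)).ofLE (t j) (ht j))) ?_)
      rw [IsIso.inv_comp_eq, Subobject.ofLE_arrow]) (Nat.zero_le n)
  have hfac : ∀ l, l < m → ∃ hj : c l < n, ∃ hxy : a l ≤ a (l + 1), i ≤ (⟨c l, hj⟩ : Fin n) ∧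
      ¬ IsZero (cokernel ((a l).ofLE (a (l + 1)) hxy)) ∧ ∃ m : ℕ,
      Nonempty (cokernel ((a l).ofLE (a (l + 1)) hxy) ≅ ⨁ fun _ : Fin m => Δ ⟨c l, hj⟩) :=
    fun l hl => (hR l hl).2.2
  let F : Filtration A := .ofSeq m a ha0 (ham.trans h0) fun l hl => (hfac l hl).2.1
  have hF : ∀ s : Fin m, ∃ hj : c s < n, σ.IsSemistable (F.factor s) ∧
      σ.phase (F.factor s) = σ.phase (Δ ⟨c s, hj⟩) ∧ IsDirectSumFrom Δ i (F.factor s) := fun s => by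
    obtain ⟨hj, hxy, hij, hz, r, ⟨e⟩⟩ := hfac s s.2
    have hss := (hσ ⟨c s, hj⟩).isSemistable_biproduct hz e
    exact ⟨hj, hss.1, hss.2, r, fun _ => ⟨c s, hj⟩, fun _ => hij, ⟨e⟩⟩
  choose hcn hss hph hsum using hF
  refine ⟨F, ⟨hss, fun s s' hs => ?_⟩, hsum⟩
  have h1 := hph s
  have h2 := hph s'
  dsimp only
  rw [h1, h2]
  exact hmono (hc s s' hs s'.2)

end StandardStable

end HighestWeight


/-! ### The equivalence -/

theorem theorem4p1 {k : Type w} [Field k] [IsAlgClosed k]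
    {C : Type u} [Category.{v} C] [Abelian C] [Linear k C]
    (hC : HighestWeight.IsDeligneFinite k C)
    {n : ℕ} (S : Fin n → C) (hS : HighestWeight.IsSimpleList S)
    (P : Fin n → C) (π : ∀ i, P i ⟶ S i)
    (hπ : ∀ i, HighestWeight.IsProjectiveCover (π i))
    (I : Fin n → C) (ι : ∀ i, S i ⟶ I i)
    (hι : ∀ i, HighestWeight.IsInjectiveHull (ι i))
    (Δ : Fin n → C) (q : ∀ i, P i ⟶ Δ i)
    (hq : ∀ i, HighestWeight.IsMaximalQuotient (HighestWeight.SerreUpTo S i) (q i))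
    (Nabla : Fin n → C) (e : ∀ i, Nabla i ⟶ I i)
    (he : ∀ i, HighestWeight.IsMaximalSubobject (HighestWeight.SerreUpTo S i) (e i)) :
    List.TFAE [
      HighestWeight.IsHighestWeight k P Δ,
      ∀ i, HighestWeight.multiplicity (Δ i) (S i) = 1 ∧
        HighestWeight.cls (P i) = ∑ j ∈ Finset.Ici i,
          HighestWeight.multiplicity (Nabla j) (S i) • HighestWeight.cls (Δ j),
      ∃ σ : HighestWeight.StabilityFunction C,
        ((∀ i, σ.IsStable (Δ i)) ∧ StrictMono fun i => σ.phase (Δ i)) ∧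
        ∀ i, ∃ F : HighestWeight.Filtration (P i), σ.IsHarderNarasimhan F ∧
          ∀ t, HighestWeight.IsDirectSumFrom Δ i (F.factor t)] := by
  have := hC.hom_finite
  have := hC.noetherian
  have := hC.artinian
  have := hS.simple
  have := fun i => (hπ i).projective
  have := fun i => (hι i).injective
  have := fun i => (hq i).epi
  have hd : HighestWeight.IsMultiplicity S fun i X => Module.finrank k (P i ⟶ X) :=
    ⟨fun i => HighestWeight.isAdditive_finrank_hom_from (P i), hS.finrank_projectiveCover hπ⟩
  have hI : ∀ i X, Module.finrank k (X ⟶ I i) = Module.finrank k (P i ⟶ X) := fun i =>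
    hd.eq_of_simple hS (HighestWeight.isAdditive_finrank_hom_to (k := k) (I i))
      (hS.finrank_injectiveHull hι i)
  simp only [hd.multiplicity_eq hS]
  tfae_have 1 → 2 := by
    intro h
    -- Maps $P_i\to\Delta_i$ factor through $\Delta_i$, so
    -- $[\Delta_i:S_i]=\dim\mathrm{End}(\Delta_i)$.
    have hΔ : ∀ i, Module.finrank k (P i ⟶ Δ i) = 1 := fun i => by
      obtain ⟨f⟩ := (h i).1
      rw [← (hq i).finrank_eq (hd.serreUpTo_of_mono hS i) (hq i).mem, ← Module.finrank_self k]
      exact f.toLinearEquiv.finrank_eq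
    refine fun i => ⟨hΔ i, ?_⟩
    rw [HighestWeight.cls_eq_sum_of_extensionClosure hS hd hI hq he hΔ i (h i).2]
  tfae_have 2 → 3 := by
    intro h
    obtain ⟨σ, hσ, hmono⟩ := HighestWeight.exists_stabilityFunction (Δ := Δ) hS hd
      (fun i => (h i).1) (fun i => (hd.serreUpTo_iff hS i _).1 (hq i).mem)
      (fun i => HighestWeight.finrank_subobject_standard (q i) (h i).1)
    refine ⟨σ, ⟨hσ, hmono⟩, fun i => ?_⟩
    obtain ⟨t, ht, h0, hn, hj⟩ :=
      HighestWeight.exists_standard_filtration hS hd hI hq he i (h i).2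
    exact HighestWeight.exists_isHarderNarasimhan hσ hmono i t ht h0 hn hj
  tfae_have 3 → 1 := by
    rintro ⟨σ, ⟨hσ, -⟩, hF⟩ i
    refine ⟨(hσ i).nonempty_algEquiv, ?_⟩
    obtain ⟨F, -, hF⟩ := hF i
    refine HighestWeight.extensionClosure_of_filtration F fun t => ?_
    obtain ⟨m, c, hc, ⟨e⟩⟩ := hF t
    exact .iso (.biproduct _ fun a => ⟨c a, hc a, ⟨CategoryTheory.Iso.refl _⟩⟩) e.symm
  tfae_finish
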